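/- Setting. Let $d\ge 1$, let $X\subset\mathbb R$ carry a probability measure $\mu$, and let $\Omega=X^{\mathbb Z^d}$ with the $\sigma$-algebra generated by the cylinders and $\mathbb P=\bigotimes_{k\in\mathbb Z^d}\mu$. For $j\in\mathbb Z^d$ put $(S_j\omega)_k=\omega_{k+j}$, and on $\mathcal H=l^2(\mathbb Z^d)$, with canonical basis $(\varphi_k)$, let $V_j$ be the unitary with $V_j\varphi_k=\varphi_{k-j}$. Let $\gamma_1,\dots,\gamma_d\in\mathbb Z^d$ be linearly independent, $\Gamma$ the lattice they span, and $B=\{\sum_i x_i\gamma_i : 0\le x_i<1\}\cap\mathbb Z^d$. Let $\omega\mapsto T_\omega\in\mathcal B(\mathcal H)$ be weakly measurable, each $T_\omega$ a completely non unitary (cnu) contraction, with $T_{S_g\omega}=V_gT_\omega V_g^{-1}$ for all $g\in\Gamma$ and $\omega\in\Omega$. For a holomorphic $f(z)=\sum_{n\ge0}a_nz^n$ on the open unit disk $\mathbb D$ let $f(T_\omega)=\mathrm{s}\text{-}\lim_{\rho\to1^-}\sum_n a_n\rho^nT_\omega^n$, whenever this exists, and let $$L(f)=\frac1{|B|}\sum_{b\in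 B}\mathbb E\,\langle\varphi_b|f(T_\omega)\varphi_b\rangle .$$ $A(\mathbb D)$ denotes the functions that are continuous on $\overline{\mathbb D}$ and holomorphic on $\mathbb D$. For $n\in\mathbb N$ let $\Lambda=\Lambda_n=\bigcup_{-n\le n_i\le n}\bigl(B+\sum_i n_i\gamma_i\bigr)$, let $\mathcal H_\Lambda=\mathrm{span}\{\varphi_j: j\in\Lambda\}$, and let $P_\Lambda$ be the orthogonal projection onto it. For all $n$ and $\omega$ let $T_\omega^\Lambda$ be a cnu contraction on $\mathcal H_\Lambda$ and $T_\omega^{\Lambda^C}$ a bounded operator on $\mathcal H_\Lambda^\perp$ such that $T_\omega-T_\omega^\Lambda\oplus T_\omega^{\Lambda^C}$ is trace class and, for every $\omega$, $\|P_\Lambda(T_\omega-T_\omega^\Lambda\oplus T_\omega^{\Lambda^C})\|_1=o(|\Lambda|)$ as $n\to\infty$. Assume that for some $r<1$ the spectral radius of $T_\omega^\Lambda$ is at most $r$ for all $n$ and all $\omega$. Put $\mathbb D/r=\{z\in\mathbb C: r|z|<1\}$. Claim. For $f\in A(\mathbb D)$ the strong limits and the expectations that define $f(T_\omega)$ and $L(f)$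 exist. There is a function $\psi(z)=\sum_{n\ge0}b_nz^n$, holomorphic on $\mathbb D/r$, with $$L(f)=\int_0^{2\pi}f(e^{it})\,\overline{\psi(e^{it})}\,\frac{dt}{2\pi}\qquad\text{for all } f\in A(\mathbb D),$$ and it is the only holomorphic function on $\mathbb D/r$ with this property. Let $L^2_+(\mathbb T)$ be the space of functions in $L^2(\mathbb T,dt/2\pi)$ whose negative Fourier coefficients vanish. Then the boundary values of $\psi$ and of every $f(z)=\sum_{n\ge0} a_nz^n\in A(\mathbb D)$ lie in $L^2_+(\mathbb T)$, their Fourier coefficients are $\hat\psi=(b_n)$ and $\hat f=(a_n)$, which lie in $l^2(\mathbb N)$, and (scalar products being conjugate linear in the first argument) $$L(f)=\langle\psi|f\rangle_{L^2_+(\mathbb T)}=\langle\hat\psi|\hat f\rangle_{l^2(\mathbb N)}=\sum_{n=0}^\infty\bar b_na_n .$$ Moreover, let $\varphi=\overline\psi$ on $\mathbb T$, let $P[\varphi]$ be its Poisson integral, and let $$m_\varphi(x,y)=\frac1{2\pi}(\partial_x+i\partial_y)\{(x-iy)P[\varphi](x,y)\}$$ on $\mathbb D$, where the differentiated function is differentiable.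 Then $$m_\varphi(z)=\frac1\pi\,\frac{\partial}{\partial\bar z}\left\{\overline{\psi(z)z}\right\}\quad(z\in\mathbb D),$$ and for all $f\in A(\mathbb D)$ the function $f\,m_\varphi$ is integrable on $\mathbb D$ and $L(f)=\int_{\mathbb D}f(x+iy)\,m_\varphi(x,y)\,dx\,dy$. -/

import Mathlib

open MeasureTheory Filter Topology
open scoped ENNReal NNReal ComplexConjugate InnerProductSpace

noncomputable section

namespace DOS

/-! ### The lattice, the probability space and the Hilbert space -/

/-- The sites, i.e. the points of `ℤ^d`. -/
abbrev Site (d : ℕ) : Type := Fin d → ℤ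

/-- The Hilbert space `l²(ℤ^d)`. -/
abbrev Hil (d : ℕ) : Type := lp (fun _ : Site d => ℂ) 2

/-- The canonical basis vector at the site `j`. -/
def basisVec {d : ℕ} (j : Site d) : Hil d := lp.single 2 j 1

/-- The sample space `X^{ℤ^d}`; it carries the σ-algebra generated by the cylinders. -/
abbrev Sample (d : ℕ) (X : Set ℝ) : Type := Site d → X

/-- The product measure `⊗_{k ∈ ℤ^d} μ`. -/
def prodMeasure (d : ℕ) {X : Set ℝ} (μ : Measure X) : Measure (Sample d X) :=
  Measure.infinitePi (fun _ : Site d => μ)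

/-- The shift `(S_j ω)_k = ω_{k + j}`. -/
def shift {d : ℕ} {X : Set ℝ} (j : Site d) (ω : Sample d X) : Sample d X := fun k => ω (k + j)

theorem memlp_translate {d : ℕ} (j : Site d) (x : Hil d) :
    Memℓp (fun k : Site d => x (k + j)) 2 := by
  have h := lp.memℓp x
  rw [memℓp_gen_iff (by norm_num)] at h ⊢
  exact (Equiv.addRight j).summable_iff.mpr h

/-- The unitary translation `(V_j x)_k = x_{k + j}`. -/
def translation {d : ℕ} (j : Site d) : Hil d ≃ₗᵢ[ℂ] Hil d where
  toFun x := ⟨fun k => x (k + j), memlp_translate j x⟩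
  invFun x := ⟨fun k => x (k + -j), memlp_translate (-j) x⟩
  left_inv x := by
    ext k
    change x (k + -j + j) = x k
    simp
  right_inv x := by
    ext k
    change x (k + j + -j) = x k
    simp
  map_add' x y := rfl
  map_smul' c x := rfl
  norm_map' x := by
    rw [lp.norm_eq_tsum_rpow (by norm_num), lp.norm_eq_tsum_rpow (by norm_num)]
    congr 1
    exact (Equiv.addRight j).tsum_eq (fun k => ‖x k‖ ^ (2 : ℝ≥0∞).toReal)

/-- `V_j` sends the basis vector at `k` to the basis vector at `k - j`. -/
theorem translation_basisVec {d : ℕ} (j k : Site d) :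
    translation j (basisVec k) = basisVec (k - j) := by
  ext m
  change (basisVec k : Hil d) (m + j) = (basisVec (k - j) : Hil d) m
  simp only [basisVec, lp.single_apply, Pi.single_apply, eq_sub_iff_add_eq]

/-- The lattice `Γ` spanned by the vectors `γ_i`. -/
def lattice {d : ℕ} (γ : Fin d → Site d) : Submodule ℤ (Site d) :=
  Submodule.span ℤ (Set.range γ)

/-- The primitive cell `{∑ x_i γ_i | 0 ≤ x_i < 1} ∩ ℤ^d`. -/
def cellSet {d : ℕ} (γ : Fin d → Site d) : Set (Site d) :=
  {j | ∃ x : Fin d → ℝ, (∀ i, 0 ≤ x i ∧ x i < 1) ∧ ∀ k, (j k : ℝ) = ∑ i, x i * (γ i k : ℝ)}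

theorem cellSet_finite {d : ℕ} (γ : Fin d → Site d) : (cellSet γ).Finite := by
  refine (Set.finite_Icc (fun k => -∑ i, |γ i k|) (fun k => ∑ i, |γ i k|)).subset ?_
  rintro j ⟨x, hx, hj⟩
  have key : ∀ k, |j k| ≤ ∑ i, |γ i k| := by
    intro k
    have h : |(j k : ℝ)| ≤ ∑ i, |(γ i k : ℝ)| := by
      rw [hj k]
      refine (Finset.abs_sum_le_sum_abs _ _).trans (Finset.sum_le_sum fun i _ => ?_)
      rw [abs_mul, abs_of_nonneg (hx i).1]
      exact mul_le_of_le_one_left (abs_nonneg _) (hx i).2.le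
    exact_mod_cast h
  exact ⟨fun k => (abs_le.mp (key k)).1, fun k => (abs_le.mp (key k)).2⟩

/-- The primitive cell `B` as a finite set. -/
def cell {d : ℕ} (γ : Fin d → Site d) : Finset (Site d) := (cellSet_finite γ).toFinset

/-- The finite box `Λ = ⋃_{-n ≤ n_i ≤ n} (B + ∑ n_i γ_i)`. -/
def box {d : ℕ} (γ : Fin d → Site d) (n : ℕ) : Finset (Site d) :=
  (cell γ ×ˢ Fintype.piFinset fun _ : Fin d => Finset.Icc (-(n : ℤ)) n).image
    fun p => p.1 + ∑ i, p.2 i • γ i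

/-- `H_Λ`, the span of the basis vectors at the sites of `Λ`. -/
def boxSpace {d : ℕ} (Λ : Finset (Site d)) : Submodule ℂ (Hil d) :=
  Submodule.span ℂ (basisVec '' (Λ : Set (Site d)))

instance {d : ℕ} (Λ : Finset (Site d)) : FiniteDimensional ℂ (boxSpace Λ) :=
  FiniteDimensional.span_of_finite ℂ (Λ.finite_toSet.image _)

instance {d : ℕ} (Λ : Finset (Site d)) : CompleteSpace (boxSpace Λ) :=
  FiniteDimensional.complete ℂ _

/-! ### Operators -/

/-- A contraction `T` is completely non unitary if the subspace
`{x | ‖T^n x‖ = ‖x‖ = ‖T*^n x‖ for all n}`, which carries its unitary part, is trivial. -/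
def IsCNU {E : Type*} [NormedAddCommGroup E] [InnerProductSpace ℂ E] [CompleteSpace E]
    (T : E →L[ℂ] E) : Prop :=
  ∀ x : E, (∀ n : ℕ, ‖(T ^ n) x‖ = ‖x‖ ∧ ‖(ContinuousLinearMap.adjoint T ^ n) x‖ = ‖x‖) → x = 0

/-- The operator `A ⊕ B` on `E = K ⊕ Kᗮ`. -/
def blockSum {E : Type*} [NormedAddCommGroup E] [InnerProductSpace ℂ E]
    (K : Submodule ℂ E) [CompleteSpace K] [CompleteSpace E]
    (A : K →L[ℂ] K) (B : Kᗮ →L[ℂ] Kᗮ) : E →L[ℂ] E :=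
  K.subtypeL ∘L A ∘L K.orthogonalProjectionOnto + Kᗮ.subtypeL ∘L B ∘L Kᗮ.orthogonalProjectionOnto

/-- The absolute value `|A| = (A* A)^{1/2}`. -/
def absOp {E : Type*} [NormedAddCommGroup E] [InnerProductSpace ℂ E] [CompleteSpace E]
    (A : E →L[ℂ] E) : E →L[ℂ] E :=
  CFC.abs A

/-- The trace norm `‖A‖₁ = tr |A|`, with values in `[0, ∞]`. -/
def traceNorm {d : ℕ} (A : Hil d →L[ℂ] Hil d) : ℝ≥0∞ :=
  ∑' j : Site d, ENNReal.ofReal (⟪basisVec j, absOp A (basisVec j)⟫_ℂ).re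

/-- `A` is trace class. -/
def IsTraceClass {d : ℕ} (A : Hil d →L[ℂ] Hil d) : Prop := traceNorm A < ∞

/-! ### Holomorphic functions and functional calculus -/

/-- The disk algebra: `f` is holomorphic on the open unit disk and continuous on the closed one. -/
def DiskAlgebra (f : ℂ → ℂ) : Prop := DiffContOnCl ℂ f (Metric.ball 0 1)

/-- The Taylor coefficients at the origin. -/
def taylorCoeff (f : ℂ → ℂ) (n : ℕ) : ℂ := iteratedDeriv n f 0 / (n.factorial : ℂ)

/-- `u_ρ(T) = ∑ c_n ρ^n T^n`, where `u(z) = ∑ c_n z^n`. -/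
def calcAbel {E : Type*} [NormedAddCommGroup E] [InnerProductSpace ℂ E]
    (T : E →L[ℂ] E) (u : ℂ → ℂ) (ρ : ℝ) : E →L[ℂ] E :=
  ∑' n : ℕ, (taylorCoeff u n * (ρ : ℂ) ^ n) • T ^ n

/-- `u(T)`, the strong limit of `u_ρ(T)` as `ρ → 1⁻`. -/
def funcCalc {E : Type*} [NormedAddCommGroup E] [InnerProductSpace ℂ E]
    (T : E →L[ℂ] E) (u : ℂ → ℂ) (x : E) : E :=
  limUnder (𝓝[<] (1 : ℝ)) fun ρ => calcAbel T u ρ x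

/-- The density of states functional `L(f) = |B|⁻¹ ∑_{b ∈ B} 𝔼 ⟨φ_b, f(T_ω) φ_b⟩`. -/
def dos {d : ℕ} {X : Set ℝ} (μ : Measure X) (γ : Fin d → Site d)
    (T : Sample d X → Hil d →L[ℂ] Hil d) (f : ℂ → ℂ) : ℂ :=
  ((cell γ).card : ℂ)⁻¹ *
    ∑ b ∈ cell γ, ∫ ω, ⟪basisVec b, funcCalc (T ω) f (basisVec b)⟫_ℂ ∂(prodMeasure d μ)

/-! ### Integral representations on the circle and on the disk -/

instance : Fact (0 < 2 * Real.pi) := ⟨Real.two_pi_pos⟩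

/-- `L²(𝕋)`, with the normalised measure `dt / 2π`. -/
abbrev L2Circle : Type :=
  Lp ℂ 2 (AddCircle.haarAddCircle : Measure (AddCircle (2 * Real.pi)))

/-- `L²₊(𝕋)`, the functions in `L²(𝕋)` whose negative Fourier coefficients all vanish. -/
def L2Plus : Submodule ℂ L2Circle where
  carrier := {F | ∀ n : ℤ, n < 0 → fourierCoeff F n = 0}
  zero_mem' := by
    intro n _
    rw [← fourierBasis_repr]
    simp
  add_mem' := by
    intro F G hF hG n hn
    have h1 := hF n hn
    have h2 := hG n hn
    rw [← fourierBasis_repr] at h1 h2 ⊢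
    simp [h1, h2]
  smul_mem' := by
    intro c F hF n hn
    have h1 := hF n hn
    rw [← fourierBasis_repr] at h1 ⊢
    simp [h1]

/-- The function `t ↦ f(e^{it})` on `𝕋 = ℝ / 2πℤ`. -/
def onCircle (f : ℂ → ℂ) (t : AddCircle (2 * Real.pi)) : ℂ := f (AddCircle.toCircle t : ℂ)

/-- The Poisson integral of a function `φ` on the unit circle. -/
def poissonIntegral (φ : ℂ → ℂ) (z : ℂ) : ℂ :=
  Real.circleAverage (fun w => (poissonKernel 0 z w : ℂ) * φ w) 0 1

/-- `∂/∂z̄ = (∂_x + i ∂_y) / 2`. -/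
def dbar (g : ℂ → ℂ) (z : ℂ) : ℂ :=
  (1 / 2) * (fderiv ℝ g z 1 + Complex.I * fderiv ℝ g z Complex.I)

/-- `m_φ = (1 / 2π) (∂_x + i ∂_y) {(x - i y) P[φ](x, y)}`. -/
def diskDensity (φ : ℂ → ℂ) (z : ℂ) : ℂ :=
  (1 / (2 * Real.pi)) *
    (fderiv ℝ (fun w => conj w * poissonIntegral φ w) z 1 +
      Complex.I * fderiv ℝ (fun w => conj w * poissonIntegral φ w) z Complex.I)

/-- The open disk `𝔻 / r` of radius `1 / r` (the whole plane if `r = 0`). -/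
def dilatedDisk (r : ℝ≥0) : Set ℂ := {z | (r : ℝ) * ‖z‖ < 1}

end DOS

end

namespace DOS

/-! ### Circle averages and Taylor coefficients -/

/-! Everything rests on the moments `m_k = L(z^k)`, which satisfy `|m_k| ≤ r^k` (`norm_moment_le`).
Covariance under the lattice and shift invariance of the product measure give `m_k = 𝔼 |Λ|⁻¹ ∑_{j ∈
Λ} ⟨φ_j, T^k φ_j⟩` for every box `Λ`. Write `A` for the finite volume operator and `D = P_Λ(T - A ⊕
B)`. Telescoping turns `P_Λ T^k` into `(A ⊕ 0)^k P_Λ` plus `k` terms, each of the form contraction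
times `D` times contraction. The first part contributes `tr A^k`, a sum of at most `|Λ|` numbers of
modulus at most `r^k`; the remaining terms contribute at most `k ‖D‖₁ = o(|Λ|)`. Dominated
convergence as `Λ` grows gives the bound.

Von Neumann's inequality, obtained here from positivity of the operator Poisson kernel, makes the
Abel means of `f(T)` Cauchy in norm and bounded by `sup |f|`. Letting `ρ → 1` yields `L(f) = ∑ a_n
m_n` on the disk algebra (`hasSum_dos`).

Hence `ψ(z) = ∑ conj(m_n) z^n` converges on `𝔻 / r`, and Parseval's identity gives the integral over
the circle and both scalar products. Pairing with monomials recovers the coefficients of `ψ`, so it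
is unique. The Poisson integral of `conj ψ` is `conj ψ`, hence the density is `conj((zψ)') / π`: the
factor `n + 1` from the derivative cancels the `1 / (n + 1)` in `∫_𝔻 f z̄ⁿ`, and the disk integral
reduces to the same series. -/

theorem circleMap_mem_unit (θ : ℝ) : circleMap 0 1 θ ∈ Metric.sphere (0 : ℂ) 1 :=
  circleMap_mem_sphere 0 zero_le_one θ

theorem conj_mul_self_of_mem_sphere {w : ℂ} (hw : w ∈ Metric.sphere (0 : ℂ) 1) :
    conj w * w = 1 := by
  have h : ‖w‖ = 1 := by simpa using hw
  rw [mul_comm, Complex.mul_conj, Complex.normSq_eq_norm_sq, h]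
  simp

theorem continuousOn_sphere_circleMap {g : ℂ → ℂ} (hg : ContinuousOn g (Metric.sphere 0 1)) :
    Continuous fun θ : ℝ => g (circleMap 0 1 θ) :=
  hg.comp_continuous (continuous_circleMap 0 1) circleMap_mem_unit

theorem circleIntegrable_of_continuousOn {g : ℂ → ℂ}
    (hg : ContinuousOn g (Metric.sphere 0 1)) : CircleIntegrable g 0 1 :=
  ContinuousOn.circleIntegrable zero_le_one hg

theorem norm_circleAverage_le {g : ℂ → ℂ} {M : ℝ}
    (hg : ∀ w ∈ Metric.sphere (0 : ℂ) 1, ‖g w‖ ≤ M) : ‖Real.circleAverage g 0 1‖ ≤ M := by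
  have h := intervalIntegral.norm_integral_le_of_norm_le_const (a := 0) (b := 2 * Real.pi)
    (f := fun θ => g (circleMap 0 1 θ)) (C := M) fun θ _ => hg _ (circleMap_mem_unit θ)
  rw [Real.circleAverage_def, norm_smul, norm_inv, Real.norm_of_nonneg Real.two_pi_pos.le]
  rw [sub_zero, abs_of_pos Real.two_pi_pos] at h
  rw [inv_mul_le_iff₀ Real.two_pi_pos]
  linarith

theorem circleAverage_conj (g : ℂ → ℂ) :
    Real.circleAverage (fun w => conj (g w)) 0 1 = conj (Real.circleAverage g 0 1) := by
  simp only [Real.circleAverage_def, Complex.real_smul, map_mul, Complex.conj_ofReal]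
  congr 1
  simp only [intervalIntegral.integral_of_le Real.two_pi_pos.le]
  exact integral_conj

/-- Term by term integration of a dominated series over the unit circle. -/
theorem hasSum_circleAverage {g : ℕ → ℂ → ℂ} {G : ℂ → ℂ} {B : ℕ → ℝ}
    (hg : ∀ n, ContinuousOn (g n) (Metric.sphere 0 1)) (hB : Summable B)
    (hgB : ∀ n, ∀ w ∈ Metric.sphere (0 : ℂ) 1, ‖g n w‖ ≤ B n)
    (hG : ∀ w ∈ Metric.sphere (0 : ℂ) 1, HasSum (fun n => g n w) (G w)) :
    HasSum (fun n => Real.circleAverage (g n) 0 1) (Real.circleAverage G 0 1) := by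
  simp only [Real.circleAverage_def]
  refine HasSum.const_smul _ ?_
  refine intervalIntegral.hasSum_integral_of_dominated_convergence (fun n _ => B n) ?_ ?_ ?_ ?_ ?_
  · exact fun n => (continuousOn_sphere_circleMap (hg n)).aestronglyMeasurable
  · exact fun n => ae_of_all _ fun θ _ => hgB n _ (circleMap_mem_unit θ)
  · exact ae_of_all _ fun _ _ => hB
  · exact intervalIntegrable_const
  · exact ae_of_all _ fun θ _ => hG _ (circleMap_mem_unit θ)

theorem circleAverage_pow (n : ℕ) :
    Real.circleAverage (fun w => w ^ n) 0 1 = if n = 0 then 1 else 0 := by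
  have h : DiffContOnCl ℂ (fun w : ℂ => w ^ n) (Metric.ball 0 |(1 : ℝ)|) :=
    (differentiable_pow n).diffContOnCl
  rw [h.circleAverage]
  split_ifs with hn
  · simp [hn]
  · simp [hn]

theorem circleAverage_pow_mul_conj_pow (n m : ℕ) :
    Real.circleAverage (fun w => w ^ n * conj w ^ m) 0 1 = if n = m then 1 else 0 := by
  rcases le_total m n with h | h
  · obtain ⟨k, rfl⟩ := Nat.exists_eq_add_of_le h
    rw [Real.circleAverage_congr_sphere (f₂ := fun w => w ^ k), circleAverage_pow]
    · simp
    · intro w hw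
      have hw' := conj_mul_self_of_mem_sphere (by simpa using hw)
      calc w ^ (m + k) * conj w ^ m = (conj w * w) ^ m * w ^ k := by ring
        _ = w ^ k := by rw [hw', one_pow, one_mul]
  · obtain ⟨k, rfl⟩ := Nat.exists_eq_add_of_le h
    rw [Real.circleAverage_congr_sphere (f₂ := fun w => conj (w ^ k)), circleAverage_conj,
      circleAverage_pow]
    · by_cases hk : k = 0 <;> simp [hk]
    · intro w hw
      have hw' := conj_mul_self_of_mem_sphere (by simpa using hw)
      calc w ^ n * conj w ^ (n + k) = (conj w * w) ^ n * conj w ^ k := by ring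
        _ = conj (w ^ k) := by rw [hw', one_pow, one_mul, map_pow]

/-- The coefficients of an absolutely convergent power series as circle averages. -/
theorem circleAverage_mul_conj_pow_of_hasSum {c : ℕ → ℂ} (hc : Summable fun n => ‖c n‖)
    {u : ℂ → ℂ} (hu : ∀ w ∈ Metric.sphere (0 : ℂ) 1, HasSum (fun n => c n * w ^ n) (u w)) (m : ℕ) :
    Real.circleAverage (fun w => u w * conj w ^ m) 0 1 = c m := by
  have h := hasSum_circleAverage (g := fun n w => c n * (w ^ n * conj w ^ m))
    (G := fun w => u w * conj w ^ m) (B := fun n => ‖c n‖)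
    (fun n => by fun_prop) hc ?_ ?_
  · have h2 : (fun n => Real.circleAverage (fun w => c n * (w ^ n * conj w ^ m)) 0 1) =
        fun n => if n = m then c m else 0 := by
      funext n
      have := Real.circleAverage_fun_smul (a := c n) (f := fun w => w ^ n * conj w ^ m)
        (c := 0) (R := 1)
      simp only [smul_eq_mul] at this
      rw [this, circleAverage_pow_mul_conj_pow]
      split_ifs with hnm <;> simp [hnm]
    rw [h2] at h
    exact h.unique (hasSum_ite_eq m (c m))
  · intro n w hw
    have hw : ‖w‖ = 1 := by simpa using hw
    simp [hw]
  · intro w hw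
    simpa only [mul_assoc] using (hu w hw).mul_right (conj w ^ m)

theorem hasSum_taylorCoeff {u : ℂ → ℂ} {R : ℝ} (hu : DifferentiableOn ℂ u (Metric.ball 0 R))
    {z : ℂ} (hz : z ∈ Metric.ball (0 : ℂ) R) :
    HasSum (fun n => taylorCoeff u n * z ^ n) (u z) := by
  have h := Complex.hasSum_taylorSeries_on_ball hu hz
  have he : (fun n => taylorCoeff u n * z ^ n) =
      fun n => (n.factorial : ℂ)⁻¹ • (z - 0) ^ n • iteratedDeriv n u 0 := by
    funext n
    simp only [taylorCoeff, sub_zero, smul_eq_mul]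
    ring
  rwa [he]

theorem DiskAlgebra.differentiableOn {f : ℂ → ℂ} (hf : DiskAlgebra f) :
    DifferentiableOn ℂ f (Metric.ball 0 1) :=
  DiffContOnCl.differentiableOn hf

theorem DiskAlgebra.continuousOn {f : ℂ → ℂ} (hf : DiskAlgebra f) :
    ContinuousOn f (Metric.closedBall 0 1) := by
  have h := DiffContOnCl.continuousOn hf
  rwa [closure_ball _ one_ne_zero] at h

theorem DiskAlgebra.continuousOn_sphere {f : ℂ → ℂ} (hf : DiskAlgebra f) :
    ContinuousOn f (Metric.sphere 0 1) :=
  hf.continuousOn.mono Metric.sphere_subset_closedBall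

theorem diskAlgebra_pow (n : ℕ) : DiskAlgebra fun z => z ^ n :=
  (differentiable_pow n).diffContOnCl

theorem norm_ofReal_mul_lt {ρ : ℝ} (h0 : 0 ≤ ρ) (h1 : ρ < 1) {z : ℂ} (hz : ‖z‖ ≤ 1) :
    (ρ : ℂ) * z ∈ Metric.ball (0 : ℂ) 1 := by
  simp only [mem_ball_zero_iff, norm_mul, Complex.norm_real, Real.norm_of_nonneg h0]
  nlinarith [norm_nonneg z]

theorem DiskAlgebra.hasSum_dilate {f : ℂ → ℂ} (hf : DiskAlgebra f) {ρ : ℝ} (h0 : 0 ≤ ρ)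
    (h1 : ρ < 1) {z : ℂ} (hz : ‖z‖ ≤ 1) :
    HasSum (fun n => taylorCoeff f n * (ρ : ℂ) ^ n * z ^ n) (f (ρ * z)) := by
  have h := hasSum_taylorCoeff hf.differentiableOn (norm_ofReal_mul_lt h0 h1 hz)
  simpa only [mul_pow, mul_assoc] using h

theorem DiskAlgebra.summable_norm {f : ℂ → ℂ} (hf : DiskAlgebra f) {ρ : ℝ} (h0 : 0 ≤ ρ)
    (h1 : ρ < 1) : Summable fun n => ‖taylorCoeff f n * (ρ : ℂ) ^ n‖ := by
  -- At `z = 1` the dilated power series is the series of its coefficients, and summability in `ℂ`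
  -- is absolute.
  have h := (hf.hasSum_dilate h0 h1 (z := 1) (by simp)).summable.norm
  simpa using h

/-- The dilations `f(ρ ·)` of a function of the disk algebra converge to it uniformly. -/
theorem DiskAlgebra.eventually_dilate {f : ℂ → ℂ} (hf : DiskAlgebra f) {ε : ℝ} (hε : 0 < ε) :
    ∀ᶠ ρ : ℝ in 𝓝[<] 1, (0 ≤ ρ ∧ ρ < 1) ∧ ∀ z : ℂ, ‖z‖ ≤ 1 → ‖f (ρ * z) - f z‖ ≤ ε := by
  have huc := (isCompact_closedBall (0 : ℂ) 1).uniformContinuousOn_of_continuous hf.continuousOn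
  obtain ⟨δ, hδ, h⟩ := Metric.uniformContinuousOn_iff_le.mp huc ε hε
  have hmem : Set.Ioo (max 0 (1 - δ)) 1 ∈ 𝓝[<] (1 : ℝ) :=
    Ioo_mem_nhdsLT (max_lt one_pos (by linarith))
  filter_upwards [hmem] with ρ hρ
  have h0 : 0 ≤ ρ := (le_max_left _ _).trans hρ.1.le
  have hδ' : 1 - δ < ρ := (le_max_right _ _).trans_lt hρ.1
  refine ⟨⟨h0, hρ.2⟩, fun z hz => ?_⟩
  rw [← dist_eq_norm]
  refine h _ (Metric.ball_subset_closedBall (norm_ofReal_mul_lt h0 hρ.2 hz)) z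
    (by simpa using hz) ?_
  have : (ρ : ℂ) * z - z = ((ρ - 1 : ℝ) : ℂ) * z := by push_cast; ring
  rw [dist_eq_norm, this, norm_mul, Complex.norm_real, Real.norm_eq_abs,
    abs_of_nonpos (by linarith [hρ.2])]
  nlinarith [norm_nonneg z, hρ.2]

/-- Uniform convergence of the dilations carries coefficient formulas from `f(ρ ·)`, whose series
converges absolutely on the circle, to `f`, whose Taylor series need not converge there. -/
theorem DiskAlgebra.tendsto_circleAverage {f : ℂ → ℂ} (hf : DiskAlgebra f) {g : ℂ → ℂ}
    (hg : Continuous g) (hg1 : ∀ w ∈ Metric.sphere (0 : ℂ) 1, ‖g w‖ ≤ 1) :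
    Tendsto (fun ρ : ℝ => Real.circleAverage (fun w => f (ρ * w) * g w) 0 1) (𝓝[<] 1)
      (𝓝 (Real.circleAverage (fun w => f w * g w) 0 1)) := by
  rw [Metric.tendsto_nhds]
  intro ε hε
  filter_upwards [hf.eventually_dilate (half_pos hε)] with ρ hρ
  have hsub : ∀ w ∈ Metric.sphere (0 : ℂ) 1, ‖w‖ = 1 := fun w hw => by simpa using hw
  have hc : ContinuousOn (fun w : ℂ => f (ρ * w)) (Metric.sphere 0 1) :=
    hf.continuousOn.comp (by fun_prop) fun w hw =>
      Metric.ball_subset_closedBall (norm_ofReal_mul_lt hρ.1.1 hρ.1.2 (hsub w hw).le)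
  rw [dist_eq_norm, ← Real.circleAverage_fun_sub (f₁ := fun w : ℂ => f (ρ * w) * g w)
    (f₂ := fun w => f w * g w) (circleIntegrable_of_continuousOn (hc.mul hg.continuousOn))
    (circleIntegrable_of_continuousOn (hf.continuousOn_sphere.mul hg.continuousOn))]
  refine (norm_circleAverage_le (M := ε / 2) fun w hw => ?_).trans_lt (half_lt_self hε)
  rw [← sub_mul, norm_mul]
  calc _ ≤ ε / 2 * 1 :=
        mul_le_mul (hρ.2 w (hsub w hw).le) (hg1 w hw) (norm_nonneg _) (half_pos hε).le
    _ = ε / 2 := mul_one _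

theorem norm_conj_pow_le {w : ℂ} (hw : w ∈ Metric.sphere (0 : ℂ) 1) (m : ℕ) :
    ‖conj w ^ m‖ ≤ 1 := by
  have hw : ‖w‖ = 1 := by simpa using hw
  simp [hw]

theorem tendsto_ofReal_pow (n : ℕ) :
    Tendsto (fun ρ : ℝ => (ρ : ℂ) ^ n) (𝓝[<] 1) (𝓝 1) := by
  have h : Continuous fun ρ : ℝ => (ρ : ℂ) ^ n := by fun_prop
  have := (h.tendsto 1).mono_left (nhdsWithin_le_nhds (s := Set.Iio (1 : ℝ)))
  simpa using this

/-- The nonnegative Fourier coefficients of a function of the disk algebra. -/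
theorem DiskAlgebra.circleAverage_mul_conj_pow {f : ℂ → ℂ} (hf : DiskAlgebra f) (m : ℕ) :
    Real.circleAverage (fun w => f w * conj w ^ m) 0 1 = taylorCoeff f m := by
  have h1 := hf.tendsto_circleAverage (g := fun w => conj w ^ m) (by fun_prop)
    fun w hw => norm_conj_pow_le hw m
  refine tendsto_nhds_unique h1 ?_
  have h2 : Tendsto (fun ρ : ℝ => taylorCoeff f m * (ρ : ℂ) ^ m) (𝓝[<] 1)
      (𝓝 (taylorCoeff f m)) := by
    simpa using (tendsto_ofReal_pow m).const_mul (taylorCoeff f m)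
  refine h2.congr' ?_
  filter_upwards [hf.eventually_dilate one_pos] with ρ hρ
  refine (circleAverage_mul_conj_pow_of_hasSum (hf.summable_norm hρ.1.1 hρ.1.2) ?_ m).symm
  intro w hw
  exact hf.hasSum_dilate hρ.1.1 hρ.1.2 (by simpa using hw.le)

/-- The negative Fourier coefficients of a function of the disk algebra vanish. -/
theorem DiskAlgebra.circleAverage_mul_pow {f : ℂ → ℂ} (hf : DiskAlgebra f) {m : ℕ} (hm : m ≠ 0) :
    Real.circleAverage (fun w => f w * w ^ m) 0 1 = 0 := by
  -- Mean value property: the integrand is itself in the disk algebra and vanishes at the origin.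
  have h : DiffContOnCl ℂ (fun w : ℂ => f w * w ^ m) (Metric.ball 0 |(1 : ℝ)|) := by
    rw [abs_one]
    exact DiffContOnCl.smul hf (differentiable_pow m).diffContOnCl
  rw [h.circleAverage]
  simp [hm]

theorem DiskAlgebra.exists_bound {f : ℂ → ℂ} (hf : DiskAlgebra f) :
    ∃ M : ℝ, 0 ≤ M ∧ ∀ z : ℂ, ‖z‖ ≤ 1 → ‖f z‖ ≤ M := by
  obtain ⟨M, hM⟩ := (isCompact_closedBall (0 : ℂ) 1).exists_bound_of_continuousOn hf.continuousOn
  exact ⟨M, (norm_nonneg _).trans (hM 0 (by simp)), fun z hz => hM z (by simpa using hz)⟩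

theorem DiskAlgebra.norm_taylorCoeff_le {f : ℂ → ℂ} (hf : DiskAlgebra f) :
    ∃ M : ℝ, ∀ n, ‖taylorCoeff f n‖ ≤ M := by
  obtain ⟨M, hM0, hM⟩ := hf.exists_bound
  refine ⟨M, fun n => ?_⟩
  rw [← hf.circleAverage_mul_conj_pow n]
  refine norm_circleAverage_le fun w hw => ?_
  rw [norm_mul]
  calc _ ≤ M * 1 := mul_le_mul (hM w (by simpa using hw.le)) (norm_conj_pow_le hw n)
        (norm_nonneg _) hM0
    _ = M := mul_one M

/-! ### Von Neumann's inequality and the functional calculus on the disk algebra -/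

section VonNeumann

variable {E : Type*} [NormedAddCommGroup E] [InnerProductSpace ℂ E]

theorem norm_pow_apply_le {S : E →L[ℂ] E} {s : ℝ} (hs : ‖S‖ ≤ s) (n : ℕ) (x : E) :
    ‖(S ^ n) x‖ ≤ s ^ n * ‖x‖ := by
  induction n with
  | zero => simp
  | succ n ih =>
    rw [pow_succ' S, mul_apply_eq_comp]
    have hs0 : 0 ≤ s := (norm_nonneg _).trans hs
    calc ‖S ((S ^ n) x)‖ ≤ ‖S‖ * ‖(S ^ n) x‖ := S.le_opNorm _
      _ ≤ s * (s ^ n * ‖x‖) := mul_le_mul hs ih (norm_nonneg _) hs0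
      _ = s ^ (n + 1) * ‖x‖ := by ring

theorem norm_pow_le_of_le {S : E →L[ℂ] E} {s : ℝ} (hs : ‖S‖ ≤ s) (n : ℕ) :
    ‖S ^ n‖ ≤ s ^ n :=
  ContinuousLinearMap.opNorm_le_bound _ (pow_nonneg ((norm_nonneg _).trans hs) n)
    (norm_pow_apply_le hs n)

/-- The defect form `a, b ↦ ⟪a, b⟫ - ⟪S a, S b⟫` of a contraction `S` is dominated by its
diagonal. -/
theorem two_mul_norm_defect_le {S : E →L[ℂ] E} (hS : ‖S‖ ≤ 1) (a b : E) :
    2 * ‖⟪a, b⟫_ℂ - ⟪S a, S b⟫_ℂ‖ ≤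
      (‖a‖ ^ 2 - ‖S a‖ ^ 2) + (‖b‖ ^ 2 - ‖S b‖ ^ 2) := by
  -- A unimodular `θ` rotates the form onto the nonnegative reals; expanding `‖S (a - θ • b)‖² ≤ ‖a
  -- - θ • b‖²` then gives the claim.
  obtain ⟨θ, hθ, hθq⟩ : ∃ θ : ℂ, ‖θ‖ = 1 ∧
      θ * (⟪a, b⟫_ℂ - ⟪S a, S b⟫_ℂ) = ‖⟪a, b⟫_ℂ - ⟪S a, S b⟫_ℂ‖ := by
    obtain ⟨θ, hθ, h⟩ := RCLike.exists_norm_eq_mul_self (⟪a, b⟫_ℂ - ⟪S a, S b⟫_ℂ)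
    exact ⟨θ, hθ, h.symm⟩
  have key : ‖S (a - θ • b)‖ ^ 2 ≤ ‖a - θ • b‖ ^ 2 := by
    have h : ‖S (a - θ • b)‖ ≤ ‖a - θ • b‖ := by
      simpa using S.le_of_opNorm_le hS (a - θ • b)
    gcongr
  rw [map_sub, map_smul, @norm_sub_sq ℂ, @norm_sub_sq ℂ, inner_smul_right, inner_smul_right,
    norm_smul, norm_smul, hθ] at key
  have h2 : (θ * ⟪a, b⟫_ℂ).re - (θ * ⟪S a, S b⟫_ℂ).re = ‖⟪a, b⟫_ℂ - ⟪S a, S b⟫_ℂ‖ := by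
    rw [← Complex.sub_re, ← mul_sub, hθq, Complex.ofReal_re]
  simp only [RCLike.re_to_complex] at key
  linarith

/-- The series `∑ w̄ⁿ ⟪x, Sⁿ y⟫`. -/
noncomputable def resolventForm (S : E →L[ℂ] E) (x y : E) (w : ℂ) : ℂ :=
  ∑' n : ℕ, ⟪x, (S ^ n) y⟫_ℂ * conj w ^ n

theorem norm_resolventForm_term_le {S : E →L[ℂ] E} {s : ℝ} (hs : ‖S‖ ≤ s) (x y : E) (n : ℕ)
    {w : ℂ} (hw : w ∈ Metric.sphere (0 : ℂ) 1) :
    ‖⟪x, (S ^ n) y⟫_ℂ * conj w ^ n‖ ≤ s ^ n * (‖x‖ * ‖y‖) := by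
  have hw : ‖w‖ = 1 := by simpa using hw
  rw [norm_mul, norm_pow, RCLike.norm_conj, hw, one_pow, mul_one]
  calc _ ≤ ‖x‖ * ‖(S ^ n) y‖ := norm_inner_le_norm _ _
    _ ≤ ‖x‖ * (s ^ n * ‖y‖) := by gcongr; exact norm_pow_apply_le hs n y
    _ = s ^ n * (‖x‖ * ‖y‖) := by ring

theorem summable_resolventForm_bound {S : E →L[ℂ] E} {s : ℝ} (hs : ‖S‖ ≤ s) (hs1 : s < 1)
    (C : ℝ) : Summable fun n : ℕ => s ^ n * C :=
  (summable_geometric_of_lt_one ((norm_nonneg _).trans hs) hs1).mul_right _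

theorem hasSum_resolventForm {S : E →L[ℂ] E} {s : ℝ} (hs : ‖S‖ ≤ s) (hs1 : s < 1) (x y : E)
    {w : ℂ} (hw : w ∈ Metric.sphere (0 : ℂ) 1) :
    HasSum (fun n : ℕ => ⟪x, (S ^ n) y⟫_ℂ * conj w ^ n) (resolventForm S x y w) :=
  (Summable.of_norm_bounded (summable_resolventForm_bound hs hs1 _)
    fun n => norm_resolventForm_term_le hs x y n hw).hasSum

theorem continuousOn_resolventForm {S : E →L[ℂ] E} {s : ℝ} (hs : ‖S‖ ≤ s) (hs1 : s < 1)
    (x y : E) : ContinuousOn (resolventForm S x y) (Metric.sphere 0 1) :=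
  continuousOn_tsum (fun n => by fun_prop) (summable_resolventForm_bound hs hs1 _)
    fun n _ hw => norm_resolventForm_term_le hs x y n hw

/-- On the unit circle, the Poisson kernel of `S` is the defect form of `S`, evaluated at
resolvent vectors. -/
theorem exists_resolvent_vector [CompleteSpace E] {S : E →L[ℂ] E} {s : ℝ} (hs : ‖S‖ ≤ s)
    (hs1 : s < 1) {w : ℂ} (hw : w ∈ Metric.sphere (0 : ℂ) 1) (y : E) :
    ∃ h : E, S h = w • (h - y) ∧ ∀ x, resolventForm S x y w = ⟪x, h⟫_ℂ := by
  have hw1 : ‖w‖ = 1 := by simpa using hw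
  have hsum : Summable fun n : ℕ => conj w ^ n • (S ^ n) y := by
    refine Summable.of_norm_bounded (summable_resolventForm_bound hs hs1 ‖y‖) fun n => ?_
    rw [norm_smul, norm_pow, RCLike.norm_conj, hw1, one_pow, one_mul]
    exact norm_pow_apply_le hs n y
  obtain ⟨h, hh⟩ := hsum
  refine ⟨h, ?_, fun x => ?_⟩
  -- The vector is `h = ∑ w̄ⁿ Sⁿ y`. An index shift gives `w̄ S h = h - y`, and multiplication by
  -- `w` removes `w̄`.
  · have h1 := (hasSum_nat_add_iff' 1).mpr hh
    have h2 := (hh.mapL S).const_smul (conj w)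
    have h3 : (fun n => conj w • S (conj w ^ n • (S ^ n) y)) =
        fun n => conj w ^ (n + 1) • (S ^ (n + 1)) y := by
      funext n
      rw [map_smul, smul_smul, pow_succ' S, ← pow_succ', mul_apply_eq_comp]
    rw [h3] at h2
    have h4 := h2.unique h1
    simp only [Finset.range_one, Finset.sum_singleton, pow_zero, one_smul,
      one_apply_eq_self] at h4
    rw [← h4, smul_smul, mul_comm, conj_mul_self_of_mem_sphere hw, one_smul]
  · have h1 := hh.mapL (innerSL ℂ x)
    refine (hasSum_resolventForm hs hs1 x y hw).unique ?_
    refine h1.congr_fun fun n => ?_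
    rw [innerSL_apply_apply, inner_smul_right, mul_comm]

/-- The Poisson kernel `∑ w̄ⁿ ⟪x, Sⁿ y⟫ + ∑ wⁿ ⟪Sⁿ x, y⟫ - ⟪x, y⟫` of a contraction `S`. -/
noncomputable def poissonForm (S : E →L[ℂ] E) (x y : E) (w : ℂ) : ℂ :=
  resolventForm S x y w + conj (resolventForm S y x w) - ⟪x, y⟫_ℂ

theorem continuousOn_poissonForm {S : E →L[ℂ] E} {s : ℝ} (hs : ‖S‖ ≤ s) (hs1 : s < 1)
    (x y : E) : ContinuousOn (poissonForm S x y) (Metric.sphere 0 1) :=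
  ((continuousOn_resolventForm hs hs1 x y).add
    (Complex.continuous_conj.comp_continuousOn (continuousOn_resolventForm hs hs1 y x))).sub
    continuousOn_const

/-- Positivity of the operator Poisson kernel, in the form needed to bound off-diagonal entries by
diagonal ones pointwise on the circle. -/
theorem two_mul_norm_poissonForm_le [CompleteSpace E] {S : E →L[ℂ] E} {s : ℝ} (hs : ‖S‖ ≤ s)
    (hs1 : s < 1) (x y : E) {w : ℂ} (hw : w ∈ Metric.sphere (0 : ℂ) 1) :
    2 * ‖poissonForm S x y w‖ ≤ (poissonForm S x x w).re + (poissonForm S y y w).re := by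
  -- Since `|w| = 1`, `⟪S ha, S hb⟫ = ⟪ha - a, hb - b⟫`, so the defect form equals `⟪a, hb⟫ + ⟪ha,
  -- b⟫ - ⟪a, b⟫`.
  have key : ∀ a ha b hb : E, S ha = w • (ha - a) → S hb = w • (hb - b) →
      (∀ x, resolventForm S x a w = ⟪x, ha⟫_ℂ) → (∀ x, resolventForm S x b w = ⟪x, hb⟫_ℂ) →
      poissonForm S a b w = ⟪ha, hb⟫_ℂ - ⟪S ha, S hb⟫_ℂ := by
    intro a ha b hb h1 h2 h3 h4
    rw [poissonForm, h1, h2, h3, h4, inner_smul_left, inner_smul_right, ← mul_assoc,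
      conj_mul_self_of_mem_sphere hw, one_mul, inner_conj_symm, inner_sub_left, inner_sub_right,
      inner_sub_right]
    ring
  obtain ⟨hx, hx1, hx2⟩ := exists_resolvent_vector hs hs1 hw x
  obtain ⟨hy, hy1, hy2⟩ := exists_resolvent_vector hs hs1 hw y
  rw [key x hx y hy hx1 hy1 hx2 hy2, key x hx x hx hx1 hx1 hx2 hx2,
    key y hy y hy hy1 hy1 hy2 hy2]
  refine (two_mul_norm_defect_le (hs.trans hs1.le) hx hy).trans_eq ?_
  simp only [inner_self_eq_norm_sq_to_K, Complex.sub_re]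
  norm_cast

theorem circleAverage_mul_resolventForm {S : E →L[ℂ] E} {s : ℝ} (hs : ‖S‖ ≤ s) (hs1 : s < 1)
    (x y : E) {u : ℂ → ℂ} (hu : ContinuousOn u (Metric.sphere 0 1)) {M : ℝ}
    (hM : ∀ w ∈ Metric.sphere (0 : ℂ) 1, ‖u w‖ ≤ M) :
    HasSum (fun n : ℕ => ⟪x, (S ^ n) y⟫_ℂ * Real.circleAverage (fun w => u w * conj w ^ n) 0 1)
      (Real.circleAverage (fun w => u w * resolventForm S x y w) 0 1) := by
  have hM0 : 0 ≤ M := (norm_nonneg _).trans (hM 1 (by simp))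
  have h := hasSum_circleAverage (g := fun n w => ⟪x, (S ^ n) y⟫_ℂ * (u w * conj w ^ n))
    (G := fun w => u w * resolventForm S x y w) (B := fun n => s ^ n * (M * (‖x‖ * ‖y‖)))
    (fun n => by fun_prop) (summable_resolventForm_bound hs hs1 _) ?_ ?_
  · refine h.congr_fun fun n => ?_
    exact (Real.circleAverage_fun_smul (a := ⟪x, (S ^ n) y⟫_ℂ)
      (f := fun w => u w * conj w ^ n)).symm
  · intro n w hw
    calc ‖⟪x, (S ^ n) y⟫_ℂ * (u w * conj w ^ n)‖
        = ‖u w‖ * ‖⟪x, (S ^ n) y⟫_ℂ * conj w ^ n‖ := by rw [← norm_mul]; congr 1; ring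
      _ ≤ M * (s ^ n * (‖x‖ * ‖y‖)) := mul_le_mul (hM w hw)
          (norm_resolventForm_term_le hs x y n hw) (norm_nonneg _) hM0
      _ = s ^ n * (M * (‖x‖ * ‖y‖)) := by ring
  · intro w hw
    refine ((hasSum_resolventForm hs hs1 x y hw).mul_left (u w)).congr_fun fun n => ?_
    ring

/-- The Poisson kernel represents the functional calculus of `S`. -/
theorem circleAverage_mul_poissonForm {S : E →L[ℂ] E} {s : ℝ} (hs : ‖S‖ ≤ s)
    (hs1 : s < 1) (x y : E) {u : ℂ → ℂ} (hu : ContinuousOn u (Metric.sphere 0 1)) {c : ℕ → ℂ}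
    (hc : ∀ n, Real.circleAverage (fun w => u w * conj w ^ n) 0 1 = c n)
    (hneg : ∀ n : ℕ, n ≠ 0 → Real.circleAverage (fun w => u w * w ^ n) 0 1 = 0) :
    HasSum (fun n : ℕ => c n * ⟪x, (S ^ n) y⟫_ℂ)
      (Real.circleAverage (fun w => u w * poissonForm S x y w) 0 1) := by
  obtain ⟨M, hM⟩ := (isCompact_sphere (0 : ℂ) 1).exists_bound_of_continuousOn hu
  have hu0 : Real.circleAverage u 0 1 = c 0 := by simpa using hc 0
  have h1 := circleAverage_mul_resolventForm hs hs1 x y hu hM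
  have h2 := circleAverage_mul_resolventForm hs hs1 y x (u := fun w => conj (u w))
    (Complex.continuous_conj.comp_continuousOn hu) (M := M) (by simpa using hM)
  -- The conjugate half of the kernel pairs `u` with the powers `wⁿ`. Only `n = 0` survives by
  -- `hneg`, and the subtracted `⟪x, y⟫` in the kernel cancels it.
  have h3 : Real.circleAverage (fun w => u w * conj (resolventForm S y x w)) 0 1 =
      c 0 * ⟪x, y⟫_ℂ := by
    have h4 : ∀ n : ℕ, ⟪y, (S ^ n) x⟫_ℂ *
        Real.circleAverage (fun w => conj (u w) * conj w ^ n) 0 1 =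
        if n = 0 then conj (c 0 * ⟪x, y⟫_ℂ) else 0 := by
      intro n
      have h5 : Real.circleAverage (fun w => conj (u w) * conj w ^ n) 0 1 =
          conj (Real.circleAverage (fun w => u w * w ^ n) 0 1) := by
        rw [← circleAverage_conj]
        simp only [map_mul, map_pow]
      rw [h5]
      split_ifs with hn
      · subst hn
        simp only [pow_zero, mul_one, one_apply_eq_self, map_mul, inner_conj_symm]
        rw [mul_comm, hu0]
      · rw [hneg n hn, map_zero, mul_zero]
    simp only [h4] at h2
    have h6 := h2.unique (hasSum_ite_eq 0 (conj (c 0 * ⟪x, y⟫_ℂ)))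
    have h7 := congrArg conj h6
    rw [← circleAverage_conj, Complex.conj_conj] at h7
    simpa only [map_mul, Complex.conj_conj] using h7
  have h8 : Real.circleAverage (fun w => u w * ⟪x, y⟫_ℂ) 0 1 = c 0 * ⟪x, y⟫_ℂ := by
    have := Real.circleAverage_fun_smul (a := ⟪x, y⟫_ℂ) (f := u) (c := 0) (R := 1)
    simp only [smul_eq_mul] at this
    rw [← hu0, mul_comm, ← this]
    simp only [mul_comm]
  have hi1 := circleIntegrable_of_continuousOn (hu.mul (continuousOn_resolventForm hs hs1 x y))
  have hi2 := circleIntegrable_of_continuousOn (hu.mul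
    (Complex.continuous_conj.comp_continuousOn (continuousOn_resolventForm hs hs1 y x)))
  have hi3 := circleIntegrable_of_continuousOn (hu.mul (continuousOn_const (c := ⟪x, y⟫_ℂ)))
  have h9 : Real.circleAverage (fun w => u w * poissonForm S x y w) 0 1 =
      Real.circleAverage (fun w => u w * resolventForm S x y w) 0 1 := by
    have e1 := Real.circleAverage_sub (hi1.add hi2) hi3
    rw [Real.circleAverage_add hi1 hi2] at e1
    have e2 : (fun w => u w * poissonForm S x y w) =
        ((u * resolventForm S x y + u * (⇑Complex.conjCLE ∘ resolventForm S y x)) -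
          u * fun _ => ⟪x, y⟫_ℂ) := by
      funext w
      simp only [poissonForm, Pi.add_apply, Pi.sub_apply, Pi.mul_apply, Function.comp_apply,
        Complex.conjCLE_apply]
      ring
    rw [e2]
    refine e1.trans ?_
    change Real.circleAverage (fun w => u w * resolventForm S x y w) 0 1 +
      Real.circleAverage (fun w => u w * conj (resolventForm S y x w)) 0 1 -
      Real.circleAverage (fun w => u w * ⟪x, y⟫_ℂ) 0 1 = _
    rw [h3, h8]
    ring
  rw [h9]
  refine h1.congr_fun fun n => ?_
  rw [hc n, mul_comm]

/-- Von Neumann's inequality for a strict contraction. -/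
theorem norm_tsum_smul_pow_le [CompleteSpace E] {S : E →L[ℂ] E} {s : ℝ} (hs : ‖S‖ ≤ s)
    (hs1 : s < 1) {u : ℂ → ℂ} (hu : ContinuousOn u (Metric.sphere 0 1)) {c : ℕ → ℂ}
    (hc : ∀ n, Real.circleAverage (fun w => u w * conj w ^ n) 0 1 = c n)
    (hneg : ∀ n : ℕ, n ≠ 0 → Real.circleAverage (fun w => u w * w ^ n) 0 1 = 0) {M : ℝ}
    (hM : ∀ w ∈ Metric.sphere (0 : ℂ) 1, ‖u w‖ ≤ M) :
    ‖∑' n, c n • S ^ n‖ ≤ M := by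
  have hM0 : 0 ≤ M := (norm_nonneg _).trans (hM 1 (by simp))
  have hcM : ∀ n, ‖c n‖ ≤ M := by
    intro n
    rw [← hc n]
    refine norm_circleAverage_le fun w hw => ?_
    rw [norm_mul]
    exact (mul_le_mul (hM w hw) (norm_conj_pow_le hw n) (norm_nonneg _) hM0).trans_eq (mul_one M)
  have hsum : Summable fun n => c n • S ^ n := by
    refine Summable.of_norm_bounded (summable_resolventForm_bound hs hs1 M) fun n => ?_
    rw [norm_smul, mul_comm]
    exact mul_le_mul (norm_pow_le_of_le hs n) (hcM n) (norm_nonneg _)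
      (pow_nonneg ((norm_nonneg _).trans hs) n)
  set A := ∑' n, c n • S ^ n with hA
  have hAxy : ∀ x y, ⟪x, A y⟫_ℂ = Real.circleAverage (fun w => u w * poissonForm S x y w) 0 1 := by
    intro x y
    have h1 := (hsum.hasSum.mapL (ContinuousLinearMap.apply ℂ E y)).mapL (innerSL ℂ x)
    refine (h1.congr_fun fun n => ?_).unique
      (circleAverage_mul_poissonForm hs hs1 x y hu hc hneg)
    simp
  -- The choice `u = 1` computes the total mass of the diagonal kernel.
  have hone : ∀ x, Real.circleAverage (fun w => poissonForm S x x w) 0 1 = ⟪x, x⟫_ℂ := by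
    intro x
    have h1 := circleAverage_mul_poissonForm hs hs1 x x (u := fun _ => 1) continuousOn_const
      (c := fun n => if n = 0 then 1 else 0) ?_ ?_
    · simp only [one_mul] at h1
      refine h1.unique ?_
      refine (hasSum_ite_eq 0 ⟪x, x⟫_ℂ).congr_fun fun n => ?_
      split_ifs with hn <;> simp [hn]
    · intro n
      have := circleAverage_pow_mul_conj_pow 0 n
      simpa [eq_comm] using this
    · intro n hn
      simpa [hn] using circleAverage_pow n
  have hbound : ∀ x y, ‖⟪x, A y⟫_ℂ‖ ≤ M / 2 * (‖x‖ ^ 2 + ‖y‖ ^ 2) := by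
    intro x y
    have hcx := continuousOn_sphere_circleMap (continuousOn_poissonForm hs hs1 x x)
    have hcy := continuousOn_sphere_circleMap (continuousOn_poissonForm hs hs1 y y)
    have h1 := intervalIntegral.norm_integral_le_of_norm_le (μ := volume) (a := 0)
      (b := 2 * Real.pi)
      (f := fun θ => u (circleMap 0 1 θ) * poissonForm S x y (circleMap 0 1 θ))
      (g := fun θ => M / 2 * ((poissonForm S x x (circleMap 0 1 θ)).re +
        (poissonForm S y y (circleMap 0 1 θ)).re)) Real.two_pi_pos.le
      (ae_of_all _ fun θ _ => ?_) ?_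
    · have hre : ∀ x, ∫ θ in 0..2 * Real.pi, (poissonForm S x x (circleMap 0 1 θ)).re =
          2 * Real.pi * ‖x‖ ^ 2 := by
        intro x
        have hcx := continuousOn_sphere_circleMap (continuousOn_poissonForm hs hs1 x x)
        have h2 := Complex.reCLM.intervalIntegral_comp_comm
          (hcx.intervalIntegrable (μ := volume) 0 (2 * Real.pi))
        simp only [Complex.reCLM_apply] at h2
        rw [h2]
        have h3 := hone x
        rw [Real.circleAverage_def, inv_smul_eq_iff₀ Real.two_pi_pos.ne'] at h3
        rw [h3, inner_self_eq_norm_sq_to_K]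
        simp only [Complex.real_smul]
        norm_cast
        exact Complex.re_ofReal_mul _ _
      rw [intervalIntegral.integral_const_mul, intervalIntegral.integral_add, hre, hre] at h1
      · rw [hAxy, Real.circleAverage_def, norm_smul, norm_inv,
          Real.norm_of_nonneg Real.two_pi_pos.le, inv_mul_le_iff₀ Real.two_pi_pos]
        linarith
      · exact (Complex.continuous_re.comp hcx).intervalIntegrable _ _
      · exact (Complex.continuous_re.comp hcy).intervalIntegrable _ _
    · rw [norm_mul]
      have h3 := two_mul_norm_poissonForm_le hs hs1 x y (circleMap_mem_unit θ)
      have h4 := mul_le_mul (hM _ (circleMap_mem_unit θ)) le_rfl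
        (norm_nonneg (poissonForm S x y (circleMap 0 1 θ))) hM0
      nlinarith
    · exact ((Continuous.add (Complex.continuous_re.comp hcx)
        (Complex.continuous_re.comp hcy)).const_mul _).intervalIntegrable _ _
  refine ContinuousLinearMap.opNorm_le_bound _ hM0 fun y => ?_
  by_cases hAy : ‖A y‖ = 0
  · rw [hAy]; positivity
  -- The test vector is `A y` rescaled to norm `‖y‖`, so the bound by a sum of squares becomes `‖y‖
  -- ‖A y‖ ≤ M ‖y‖²`.
  have h1 := hbound (((‖y‖ / ‖A y‖ : ℝ) : ℂ) • A y) y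
  rw [inner_smul_left, norm_mul, RCLike.norm_conj, inner_self_eq_norm_sq_to_K, norm_smul,
    Complex.norm_real, Real.norm_of_nonneg (by positivity)] at h1
  simp only [norm_pow, RCLike.norm_ofReal, abs_norm] at h1
  have h2 : ‖y‖ / ‖A y‖ * ‖A y‖ = ‖y‖ := div_mul_cancel₀ _ hAy
  have h3 : ‖y‖ / ‖A y‖ * ‖A y‖ ^ 2 = ‖y‖ * ‖A y‖ := by
    rw [sq, ← mul_assoc, h2]
  rw [h2, h3] at h1
  by_cases hy : ‖y‖ = 0
  · have : y = 0 := by simpa using hy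
    simp [this]
  · have hy' : 0 < ‖y‖ := lt_of_le_of_ne (norm_nonneg _) (Ne.symm hy)
    nlinarith

theorem DiskAlgebra.summable_norm_calcAbel {f : ℂ → ℂ} (hf : DiskAlgebra f) {T : E →L[ℂ] E}
    (hT : ‖T‖ ≤ 1) {ρ : ℝ} (h0 : 0 ≤ ρ) (h1 : ρ < 1) :
    Summable fun n : ℕ => ‖(taylorCoeff f n * (ρ : ℂ) ^ n) • T ^ n‖ := by
  refine Summable.of_nonneg_of_le (fun n => norm_nonneg _) (fun n => ?_) (hf.summable_norm h0 h1)
  rw [norm_smul]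
  have h := norm_pow_le_of_le hT n
  rw [one_pow] at h
  exact mul_le_of_le_one_right (norm_nonneg _) h

/-- Von Neumann's inequality for the strict contraction `sT` and the function `f(ρ ·) - f`. The
bound does not depend on `s`, which is what makes the Abel means Cauchy. -/
theorem DiskAlgebra.norm_calcAbel_sub_le [CompleteSpace E] {f : ℂ → ℂ} (hf : DiskAlgebra f)
    {T : E →L[ℂ] E} (hT : ‖T‖ ≤ 1) {ρ s ε : ℝ} (hρ0 : 0 ≤ ρ) (hρ1 : ρ < 1) (hs0 : 0 ≤ s)
    (hs1 : s < 1) (hε : ∀ z : ℂ, ‖z‖ ≤ 1 → ‖f (ρ * z) - f z‖ ≤ ε) :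
    ‖calcAbel T f (ρ * s) - calcAbel T f s‖ ≤ ε := by
  have hρs : ρ * s < 1 := by nlinarith
  have hsub : ∀ w ∈ Metric.sphere (0 : ℂ) 1, ‖w‖ = 1 := fun w hw => by simpa using hw
  have hc : ContinuousOn (fun w : ℂ => f (ρ * w)) (Metric.sphere 0 1) :=
    hf.continuousOn.comp (by fun_prop) fun w hw =>
      Metric.ball_subset_closedBall (norm_ofReal_mul_lt hρ0 hρ1 (hsub w hw).le)
  have hdil : ∀ n, Real.circleAverage (fun w => f (ρ * w) * conj w ^ n) 0 1 =
      taylorCoeff f n * (ρ : ℂ) ^ n :=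
    circleAverage_mul_conj_pow_of_hasSum (hf.summable_norm hρ0 hρ1)
      fun w hw => hf.hasSum_dilate hρ0 hρ1 (hsub w hw).le
  have havg : ∀ g : ℂ → ℂ, Continuous g →
      Real.circleAverage (fun w => (f (ρ * w) - f w) * g w) 0 1 =
      Real.circleAverage (fun w => f (ρ * w) * g w) 0 1 -
        Real.circleAverage (fun w => f w * g w) 0 1 := by
    intro g hg
    rw [← Real.circleAverage_fun_sub (f₁ := fun w : ℂ => f (ρ * w) * g w)
      (f₂ := fun w => f w * g w) (circleIntegrable_of_continuousOn (hc.mul hg.continuousOn))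
      (circleIntegrable_of_continuousOn (hf.continuousOn_sphere.mul hg.continuousOn))]
    simp only [sub_mul]
  have hsT : ‖(s : ℂ) • T‖ ≤ s := by
    rw [norm_smul, Complex.norm_real, Real.norm_of_nonneg hs0]
    exact mul_le_of_le_one_right hs0 hT
  have h := norm_tsum_smul_pow_le hsT hs1 (u := fun w => f (ρ * w) - f w)
    (hc.sub hf.continuousOn_sphere)
    (c := fun n => taylorCoeff f n * (ρ : ℂ) ^ n - taylorCoeff f n) ?_ ?_
    (M := ε) (fun w hw => hε w (hsub w hw).le)
  · have e : ∀ n, (taylorCoeff f n * (ρ : ℂ) ^ n - taylorCoeff f n) • ((s : ℂ) • T) ^ n =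
        (taylorCoeff f n * ((ρ * s : ℝ) : ℂ) ^ n) • T ^ n -
          (taylorCoeff f n * (s : ℂ) ^ n) • T ^ n := by
      intro n
      rw [smul_pow, smul_smul, ← sub_smul]
      congr 1
      push_cast
      ring
    simp only [e] at h
    rwa [Summable.tsum_sub (hf.summable_norm_calcAbel hT (mul_nonneg hρ0 hs0) hρs).of_norm
      (hf.summable_norm_calcAbel hT hs0 hs1).of_norm] at h
  · intro n
    rw [havg _ (by fun_prop), hdil, hf.circleAverage_mul_conj_pow]
  · intro n hn
    rw [havg _ (by fun_prop), hf.circleAverage_mul_pow hn, sub_zero]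
    have hd : DiskAlgebra fun w => f (ρ * w) := by
      refine DiffContOnCl.comp (g := fun w : ℂ => ρ * w) (t := Metric.ball 0 1) hf
        (by fun_prop : Differentiable ℂ fun w : ℂ => ρ * w).diffContOnCl fun w hw => ?_
      exact norm_ofReal_mul_lt hρ0 hρ1 (mem_ball_zero_iff.mp hw).le
    exact hd.circleAverage_mul_pow hn

/-- The functional calculus of the disk algebra converges in the operator norm. -/
theorem DiskAlgebra.exists_tendsto_calcAbel [CompleteSpace E] {f : ℂ → ℂ} (hf : DiskAlgebra f)
    {T : E →L[ℂ] E} (hT : ‖T‖ ≤ 1) :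
    ∃ A : E →L[ℂ] E, Tendsto (calcAbel T f) (𝓝[<] 1) (𝓝 A) := by
  refine cauchy_map_iff_exists_tendsto.mp ?_
  rw [Metric.cauchy_iff]
  refine ⟨inferInstance, fun ε hε => ?_⟩
  have h := hf.eventually_dilate (half_pos hε)
  obtain ⟨a, ha, hI⟩ := (mem_nhdsLT_iff_exists_Ioo_subset).mp h
  have hmem : Set.Ioo (max a 0) 1 ∈ 𝓝[<] (1 : ℝ) := Ioo_mem_nhdsLT (max_lt ha one_pos)
  refine ⟨calcAbel T f '' Set.Ioo (max a 0) 1, image_mem_map hmem, ?_⟩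
  have key : ∀ σ ∈ Set.Ioo (max a 0) 1, ∀ τ ∈ Set.Ioo (max a 0) 1, σ < τ →
      dist (calcAbel T f σ) (calcAbel T f τ) < ε := by
    intro σ hσ τ hτ hστ
    have hσ0 : 0 < σ := (le_max_right _ _).trans_lt hσ.1
    have hτ0 : 0 < τ := hσ0.trans hστ
    have h1 : σ / τ < 1 := (div_lt_one hτ0).mpr hστ
    -- With `σ = (σ / τ) τ`, the ratio is the dilation parameter; it lies above `σ`, hence within
    -- the range where the dilation moves `f` by at most `ε / 2`.
    have h2 : σ ≤ σ / τ := le_div_self hσ0.le hτ0 hτ.2.le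
    have h3 := hI (show σ / τ ∈ Set.Ioo a 1 from
      ⟨((le_max_left _ _).trans_lt hσ.1).trans_le h2, h1⟩)
    have h4 := hf.norm_calcAbel_sub_le hT h3.1.1 h3.1.2 hτ0.le hτ.2 h3.2
    rw [div_mul_cancel₀ _ hτ0.ne'] at h4
    rw [dist_eq_norm]
    exact h4.trans_lt (half_lt_self hε)
  rintro _ ⟨σ, hσ, rfl⟩ _ ⟨τ, hτ, rfl⟩
  rcases lt_trichotomy σ τ with hlt | rfl | hlt
  · exact key σ hσ τ hτ hlt
  · rwa [dist_self]
  · rw [dist_comm]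
    exact key τ hτ σ hσ hlt

/-- Von Neumann's inequality for the Abel means. -/
theorem DiskAlgebra.norm_calcAbel_le [CompleteSpace E] {f : ℂ → ℂ} (hf : DiskAlgebra f)
    {T : E →L[ℂ] E} (hT : ‖T‖ ≤ 1) {s M : ℝ} (hs0 : 0 ≤ s) (hs1 : s < 1)
    (hM : ∀ z : ℂ, ‖z‖ ≤ 1 → ‖f z‖ ≤ M) : ‖calcAbel T f s‖ ≤ M := by
  have hsT : ‖(s : ℂ) • T‖ ≤ s := by
    rw [norm_smul, Complex.norm_real, Real.norm_of_nonneg hs0]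
    exact mul_le_of_le_one_right hs0 hT
  have h := norm_tsum_smul_pow_le hsT hs1 hf.continuousOn_sphere hf.circleAverage_mul_conj_pow
    (fun n => hf.circleAverage_mul_pow) (M := M)
    (fun w hw => hM w (by simpa using (mem_sphere_zero_iff_norm.mp hw).le))
  simpa only [calcAbel, smul_pow, smul_smul] using h

theorem DiskAlgebra.tendsto_calcAbel_apply [CompleteSpace E] {f : ℂ → ℂ} (hf : DiskAlgebra f)
    {T : E →L[ℂ] E} (hT : ‖T‖ ≤ 1) (x : E) :
    Tendsto (fun ρ => calcAbel T f ρ x) (𝓝[<] 1) (𝓝 (funcCalc T f x)) := by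
  obtain ⟨A, hA⟩ := hf.exists_tendsto_calcAbel hT
  exact tendsto_nhds_limUnder
    ⟨A x, ((ContinuousLinearMap.apply ℂ E x).continuous.tendsto A).comp hA⟩

theorem DiskAlgebra.hasSum_inner_calcAbel [CompleteSpace E] {f : ℂ → ℂ} (hf : DiskAlgebra f)
    {T : E →L[ℂ] E} (hT : ‖T‖ ≤ 1) {ρ : ℝ} (h0 : 0 ≤ ρ) (h1 : ρ < 1) (x y : E) :
    HasSum (fun n => taylorCoeff f n * (ρ : ℂ) ^ n * ⟪x, (T ^ n) y⟫_ℂ)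
      ⟪x, calcAbel T f ρ y⟫_ℂ := by
  have h := ((hf.summable_norm_calcAbel hT h0 h1).of_norm.hasSum.mapL
    (ContinuousLinearMap.apply ℂ E y)).mapL (innerSL ℂ x)
  refine h.congr_fun fun n => ?_
  simp

end VonNeumann
/-! ### The trace norm -/

section AbsoluteValue

variable {E : Type*} [NormedAddCommGroup E] [InnerProductSpace ℂ E] [CompleteSpace E]

theorem absOp_nonneg (A : E →L[ℂ] E) : 0 ≤ absOp A := CFC.abs_nonneg A

theorem absOp_isSelfAdjoint (A : E →L[ℂ] E) : IsSelfAdjoint (absOp A) :=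
  (absOp_nonneg A).isSelfAdjoint

theorem absOp_mul_absOp (A : E →L[ℂ] E) : absOp A * absOp A = star A * A := CFC.abs_mul_abs A

theorem norm_sq_apply_eq (B : E →L[ℂ] E) (x : E) : ‖B x‖ ^ 2 = (⟪x, (star B * B) x⟫_ℂ).re := by
  rw [mul_apply_eq_comp, ContinuousLinearMap.star_eq_adjoint,
    ContinuousLinearMap.adjoint_inner_right, inner_self_eq_norm_sq_to_K]
  norm_cast

theorem norm_absOp_apply (A : E →L[ℂ] E) (x : E) : ‖absOp A x‖ = ‖A x‖ := by
  have h : ‖absOp A x‖ ^ 2 = ‖A x‖ ^ 2 := by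
    rw [norm_sq_apply_eq, norm_sq_apply_eq, (absOp_isSelfAdjoint A).star_eq, absOp_mul_absOp]
  exact (pow_left_inj₀ (norm_nonneg _) (norm_nonneg _) two_ne_zero).mp h

/-- An approximate factorisation `A ≈ W R` with `W* W ≤ |A|` and `R² = |A|`. -/
theorem exists_approx_factorization (A : E →L[ℂ] E) {ε : ℝ} (hε : 0 < ε) :
    ∃ W R : E →L[ℂ] E, ‖A - W * R‖ ≤ ε ∧ IsSelfAdjoint R ∧
      (∀ x, ‖W x‖ ^ 2 ≤ (⟪x, absOp A x⟫_ℂ).re) ∧ ∀ x, ‖R x‖ ^ 2 = (⟪x, absOp A x⟫_ℂ).re := by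
  set H := absOp A with hH
  have hsa : IsSelfAdjoint H := absOp_isSelfAdjoint A
  have hspec : ∀ x ∈ spectrum ℝ H, 0 ≤ x := fun x hx =>
    spectrum_nonneg_of_nonneg (absOp_nonneg A) hx
  have hcont : ContinuousOn (fun x : ℝ => √x / (x + ε)) (spectrum ℝ H) :=
    Real.continuous_sqrt.continuousOn.div (by fun_prop) fun x hx => by
      have := hspec x hx; positivity
  have hsqrt : ContinuousOn (fun x : ℝ => √x) (spectrum ℝ H) := Real.continuous_sqrt.continuousOn
  set R := cfc (fun x : ℝ => √x) H with hR
  set G := cfc (fun x : ℝ => √x / (x + ε)) H with hG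
  have hRsa : IsSelfAdjoint R := cfc_predicate _ _
  have hGsa : IsSelfAdjoint G := cfc_predicate _ _
  have hid : cfc (fun x : ℝ => x) H = H := cfc_id' ℝ H
  have hRR : R * R = H := by
    rw [hR, ← cfc_mul _ _ H hsqrt hsqrt]
    conv_rhs => rw [← hid]
    exact cfc_congr fun x hx => Real.mul_self_sqrt (hspec x hx)
  -- `G` is a regularised inverse square root of `|A|`, so `W = A G` and `R = |A|^{1/2}` replace the
  -- polar decomposition up to an error governed by `ε`.
  refine ⟨A * G, R, ?_, hRsa, fun x => ?_, fun x => ?_⟩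
  -- Because `‖A z‖ = ‖|A| z‖`, it suffices to bound `|A| (1 - G R)`, which is the function `ε x /
  -- (x + ε) ≤ ε` of `|A|`.
  · have h1 : H * (1 - G * R) = cfc (fun x : ℝ => x - x * (√x / (x + ε) * √x)) H := by
      have c1 : ContinuousOn (fun x : ℝ => √x / (x + ε) * √x) (spectrum ℝ H) := hcont.mul hsqrt
      have c2 : ContinuousOn (fun x : ℝ => x * (√x / (x + ε) * √x)) (spectrum ℝ H) :=
        continuousOn_id.mul c1
      rw [cfc_sub (fun x => x) _ H (by fun_prop) c2, cfc_mul (fun x => x) _ H (by fun_prop) c1,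
        cfc_mul _ _ H hcont hsqrt, hid,
        mul_sub, mul_one]
    have h2 : ‖H * (1 - G * R)‖ ≤ ε := by
      rw [h1]
      refine norm_cfc_le hε.le fun x hx => ?_
      have hx0 := hspec x hx
      have h3 : x - x * (√x / (x + ε) * √x) = ε * (x / (x + ε)) := by
        have h4 : √x / (x + ε) * √x = x / (x + ε) := by
          rw [div_mul_eq_mul_div, Real.mul_self_sqrt hx0]
        have h5 : x + ε ≠ 0 := by positivity
        rw [h4]
        field_simp
        ring
      rw [h3, Real.norm_of_nonneg (by positivity)]
      exact mul_le_of_le_one_right hε.le (div_le_one_of_le₀ (by linarith) (by positivity))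
    refine ContinuousLinearMap.opNorm_le_bound _ hε.le fun x => ?_
    have h3 : (A - A * G * R) x = A ((1 - G * R) x) := by
      have : A - A * G * R = A * (1 - G * R) := by rw [mul_sub, mul_one, mul_assoc]
      rw [this, mul_apply_eq_comp]
    rw [h3, ← norm_absOp_apply, ← hH, ← mul_apply_eq_comp]
    exact ContinuousLinearMap.le_of_opNorm_le _ h2 x
  · have c1 : ContinuousOn (fun x : ℝ => √x / (x + ε) * (x * x)) (spectrum ℝ H) :=
      hcont.mul (by fun_prop)
    -- `W* W = G |A|² G` is the function `x (x / (x + ε))² ≤ x` of `|A|`.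
    have h1 : star (A * G) * (A * G) =
        cfc (fun x : ℝ => √x / (x + ε) * (x * x) * (√x / (x + ε))) H := by
      rw [cfc_mul (fun x => √x / (x + ε) * (x * x)) _ H c1 hcont,
        cfc_mul _ (fun x => x * x) H hcont (by fun_prop),
        cfc_mul (fun x => x) (fun x => x) H (by fun_prop) (by fun_prop), hid, hH,
        absOp_mul_absOp, ← hH, star_mul,
        hGsa.star_eq, hG]
      simp only [mul_assoc]
    have h2 : star (A * G) * (A * G) ≤ H := by
      rw [h1]
      conv_rhs => rw [← hid]
      refine cfc_mono (fun x hx => ?_) (c1.mul hcont) (by fun_prop)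
      have hx0 := hspec x hx
      have h5 : 0 < x + ε := by positivity
      have h4 : √x / (x + ε) * (x * x) * (√x / (x + ε)) = x * (x / (x + ε)) ^ 2 := by
        have : √x / (x + ε) * (x * x) * (√x / (x + ε)) =
          (√x * √x) * (x / (x + ε)) ^ 2 := by ring
        rw [this, Real.mul_self_sqrt hx0]
      rw [h4]
      refine mul_le_of_le_one_right hx0 (pow_le_one₀ (by positivity) ?_)
      exact div_le_one_of_le₀ (by linarith) h5.le
    rw [norm_sq_apply_eq]
    have h3 := ((ContinuousLinearMap.le_def _ _).mp h2).re_inner_nonneg_right x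
    rw [sub_apply, inner_sub_right, map_sub] at h3
    exact sub_nonneg.mp h3
  · rw [norm_sq_apply_eq, hRsa.star_eq, hRR]

end AbsoluteValue

section TraceNorm

variable {d : ℕ}

theorem inner_basisVec (j : Site d) (x : Hil d) : ⟪basisVec j, x⟫_ℂ = x j := by
  rw [basisVec, lp.inner_single_left]
  simp

theorem norm_basisVec (j : Site d) : ‖(basisVec j : Hil d)‖ = 1 := by
  rw [basisVec, lp.norm_single (by norm_num)]
  simp

theorem hasSum_norm_sq_coord (x : Hil d) : HasSum (fun j => ‖x j‖ ^ 2) (‖x‖ ^ 2) := by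
  have h := lp.hasSum_norm (p := 2) (by norm_num) x
  simpa using h

theorem tsum_ofReal_norm_sq_inner (x : Hil d) :
    ∑' j, ENNReal.ofReal (‖⟪basisVec j, x⟫_ℂ‖ ^ 2) = ENNReal.ofReal (‖x‖ ^ 2) := by
  simp only [inner_basisVec]
  rw [← (hasSum_norm_sq_coord x).tsum_eq,
    ENNReal.ofReal_tsum_of_nonneg (fun _ => by positivity) (hasSum_norm_sq_coord x).summable]

/-- An operator and its adjoint have the same Hilbert-Schmidt norm. -/
theorem tsum_norm_sq_adjoint (M : Hil d →L[ℂ] Hil d) :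
    ∑' j, ENNReal.ofReal (‖star M (basisVec j)‖ ^ 2) =
      ∑' j, ENNReal.ofReal (‖M (basisVec j)‖ ^ 2) := by
  simp only [← tsum_ofReal_norm_sq_inner]
  rw [ENNReal.tsum_comm]
  refine tsum_congr fun j => tsum_congr fun k => ?_
  rw [ContinuousLinearMap.star_eq_adjoint, ContinuousLinearMap.adjoint_inner_right,
    norm_inner_symm]

/-- By `hM` the squared Hilbert-Schmidt norm of `M` is at most `‖A‖₁`, and taking adjoints preserves
that norm. -/
theorem sum_norm_sq_star_le {A : Hil d →L[ℂ] Hil d} (hA : IsTraceClass A)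
    {M : Hil d →L[ℂ] Hil d} (hM : ∀ x, ‖M x‖ ^ 2 ≤ (⟪x, absOp A x⟫_ℂ).re) (F : Finset (Site d)) :
    ∑ j ∈ F, ‖star M (basisVec j)‖ ^ 2 ≤ (traceNorm A).toReal := by
  rw [← ENNReal.ofReal_le_iff_le_toReal (ne_of_lt hA),
    ENNReal.ofReal_sum_of_nonneg fun _ _ => by positivity]
  calc _ ≤ ∑' j, ENNReal.ofReal (‖star M (basisVec j)‖ ^ 2) := ENNReal.sum_le_tsum F
    _ = ∑' j, ENNReal.ofReal (‖M (basisVec j)‖ ^ 2) := tsum_norm_sq_adjoint M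
    _ ≤ traceNorm A := ENNReal.tsum_le_tsum fun j => ENNReal.ofReal_le_ofReal (hM _)

/-- `|tr (C A D)| ≤ ‖A‖₁` for contractions `C` and `D`, for every partial sum of the trace. -/
theorem norm_sum_inner_le_traceNorm {A : Hil d →L[ℂ] Hil d} (hA : IsTraceClass A)
    {C D : Hil d →L[ℂ] Hil d} (hC : ‖C‖ ≤ 1) (hD : ‖D‖ ≤ 1) (F : Finset (Site d)) :
    ‖∑ j ∈ F, ⟪basisVec j, (C * A * D) (basisVec j)⟫_ℂ‖ ≤ (traceNorm A).toReal := by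
  have key : ∀ ε : ℝ, 0 < ε → ‖∑ j ∈ F, ⟪basisVec j, (C * A * D) (basisVec j)⟫_ℂ‖ ≤
      (traceNorm A).toReal + F.card * ε := by
    intro ε hε
    obtain ⟨W, R, hWR, hR, hW1, hR1⟩ := exists_approx_factorization A hε
    have hW2 := sum_norm_sq_star_le hA (M := C * W) (fun x => by
      refine le_trans ?_ (hW1 x)
      have : ‖(C * W) x‖ ≤ ‖W x‖ := by simpa using C.le_of_opNorm_le hC (W x)
      gcongr) F
    have hR2 := sum_norm_sq_star_le hA (M := star D * R) (fun x => by
      refine le_trans ?_ (hR1 x).le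
      have h1 : ‖star D‖ ≤ 1 := by
        rwa [ContinuousLinearMap.star_eq_adjoint, LinearIsometryEquiv.norm_map]
      have : ‖(star D * R) x‖ ≤ ‖R x‖ := by simpa using (star D).le_of_opNorm_le h1 (R x)
      gcongr) F
    -- `R D` is the adjoint of `D* R`, and the latter inherits the bound on `R` since `D*` is a
    -- contraction.
    rw [star_mul, star_star, hR.star_eq] at hR2
    calc ‖∑ j ∈ F, ⟪basisVec j, (C * A * D) (basisVec j)⟫_ℂ‖
        ≤ ∑ j ∈ F, ‖⟪basisVec j, (C * A * D) (basisVec j)⟫_ℂ‖ := norm_sum_le _ _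
      _ ≤ ∑ j ∈ F, ((‖star (C * W) (basisVec j)‖ ^ 2 + ‖(R * D) (basisVec j)‖ ^ 2) / 2 + ε) := by
          refine Finset.sum_le_sum fun j _ => ?_
          -- The main part is `⟪(C W)* φ_j, R D φ_j⟫`, estimated by `ab ≤ (a² + b²) / 2`; both sums
          -- of squares are at most `‖A‖₁`.
          have h1 : C * A * D = C * W * (R * D) + C * (A - W * R) * D := by noncomm_ring
          have h2 : ‖C * (A - W * R) * D‖ ≤ ε := by
            calc _ ≤ ‖C‖ * ‖A - W * R‖ * ‖D‖ :=
                  (norm_mul_le _ _).trans (mul_le_mul_of_nonneg_right (norm_mul_le _ _)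
                    (norm_nonneg _))
              _ ≤ 1 * ε * 1 := by gcongr
              _ = ε := by ring
          have h3 : ‖⟪basisVec j, (C * (A - W * R) * D) (basisVec j)⟫_ℂ‖ ≤ ε := by
            refine (norm_inner_le_norm _ _).trans ?_
            rw [norm_basisVec, one_mul]
            simpa [norm_basisVec] using
              (C * (A - W * R) * D).le_of_opNorm_le h2 (basisVec j : Hil d)
          rw [h1, add_apply, inner_add_right]
          refine (norm_add_le _ _).trans (add_le_add ?_ h3)
          rw [mul_apply_eq_comp (C * W), ← ContinuousLinearMap.adjoint_inner_left,
            ← ContinuousLinearMap.star_eq_adjoint]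
          refine (norm_inner_le_norm _ _).trans ?_
          nlinarith [sq_nonneg (‖star (C * W) (basisVec j)‖ - ‖(R * D) (basisVec j)‖)]
      _ ≤ (traceNorm A).toReal + F.card * ε := by
          rw [Finset.sum_add_distrib, ← Finset.sum_div, Finset.sum_add_distrib, Finset.sum_const,
            nsmul_eq_mul]
          linarith
  -- The factorisation error `F.card * ε` is arbitrarily small because `F` is finite.
  refine le_of_forall_pos_le_add fun δ hδ => ?_
  refine (key (δ / (F.card + 1)) (by positivity)).trans ?_
  gcongr
  rw [mul_div_assoc', div_le_iff₀ (by positivity)]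
  nlinarith

end TraceNorm

/-! ### Finite volume approximations -/

section FiniteVolume

variable {E : Type*} [NormedAddCommGroup E] [InnerProductSpace ℂ E]

/-- The trace of `A ^ k` is controlled by the spectral radius of `A`. -/
theorem norm_trace_pow_le [FiniteDimensional ℂ E] (A : E →L[ℂ] E) {r : ℝ≥0}
    (hr : spectralRadius ℂ A ≤ r) (k : ℕ) :
    ‖LinearMap.trace ℂ E ((A ^ k : E →L[ℂ] E) : E →ₗ[ℂ] E)‖ ≤ Module.finrank ℂ E * (r : ℝ) ^ k := by
  have : CompleteSpace E := FiniteDimensional.complete ℂ E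
  have hA : ∀ z ∈ spectrum ℂ A, ‖z‖ ≤ r := by
    intro z hz
    have h : (‖z‖₊ : ℝ≥0∞) ≤ spectralRadius ℂ A :=
      le_iSup₂ (f := fun z (_ : z ∈ spectrum ℂ A) => (‖z‖₊ : ℝ≥0∞)) z hz
    exact_mod_cast h.trans hr
  rcases Nat.eq_zero_or_pos k with rfl | hk
  -- The spectral mapping used below is for positive powers; for `k = 0` the trace is the dimension.
  · rw [pow_zero, pow_zero, mul_one, show ((1 : E →L[ℂ] E) : E →ₗ[ℂ] E) = 1 from rfl,
      LinearMap.trace_one]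
    simp
  set f : Module.End ℂ E := ((A ^ k : E →L[ℂ] E) : E →ₗ[ℂ] E) with hf
  -- The trace is the sum of the characteristic roots with multiplicity, and each root is `w ^ k`
  -- for some `w` in the spectrum of `A`.
  have hroots : ∀ z ∈ f.charpoly.roots, ‖z‖ ≤ (r : ℝ) ^ k := by
    intro z hz
    have h1 : Module.End.HasEigenvalue f z :=
      (Module.End.hasEigenvalue_iff_isRoot_charpoly f z).mpr (Polynomial.isRoot_of_mem_roots hz)
    have h2 : z ∈ spectrum ℂ (A ^ k) := by
      rw [← AlgEquiv.spectrum_eq (Module.End.toContinuousLinearMap E).symm]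
      exact Module.End.hasEigenvalue_iff_mem_spectrum.mp h1
    rw [spectrum.map_pow_of_pos A hk] at h2
    obtain ⟨w, hw, rfl⟩ := h2
    simp only [norm_pow]
    exact pow_le_pow_left₀ (norm_nonneg _) (hA w hw) k
  rw [Module.End.trace_eq_sum_roots_charpoly_of_splits (IsAlgClosed.splits _)]
  refine (norm_multiset_sum_le _).trans ?_
  refine (Multiset.sum_le_card_nsmul _ ((r : ℝ) ^ k) fun x hx => ?_).trans ?_
  · obtain ⟨z, hz, rfl⟩ := Multiset.mem_map.mp hx
    exact hroots z hz
  · rw [Multiset.card_map, nsmul_eq_mul]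
    refine mul_le_mul_of_nonneg_right ?_ (by positivity)
    have h := Polynomial.card_roots' f.charpoly
    rw [LinearMap.charpoly_natDegree] at h
    exact_mod_cast h

variable (K : Submodule ℂ E) [CompleteSpace K]

/-- The operator `A ⊕ 0` on `E = K ⊕ Kᗮ`. -/
noncomputable def extendZero (A : K →L[ℂ] K) : E →L[ℂ] E :=
  K.subtypeL ∘L A ∘L K.orthogonalProjectionOnto

theorem extendZero_pow_apply (A : K →L[ℂ] K) (k : ℕ) (y : K) :
    (extendZero K A ^ k) (y : E) = ((A ^ k) y : K) := by
  induction k with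
  | zero => simp
  | succ k ih =>
    rw [pow_succ', mul_apply_eq_comp, ih, pow_succ' A, mul_apply_eq_comp, extendZero]
    simp

theorem norm_extendZero_le {A : K →L[ℂ] K} (hA : ‖A‖ ≤ 1) : ‖extendZero K A‖ ≤ 1 := by
  refine ContinuousLinearMap.opNorm_le_bound _ zero_le_one fun x => ?_
  have h1 : ‖A (K.orthogonalProjectionOnto x)‖ ≤ 1 * ‖K.orthogonalProjectionOnto x‖ :=
    A.le_of_opNorm_le hA _
  have h2 := K.norm_orthogonalProjectionOnto_apply_le x
  change ‖A (K.orthogonalProjectionOnto x)‖ ≤ 1 * ‖x‖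
  linarith

variable [CompleteSpace E]

/-- The projection annihilates the block `B`, so the only remainder is `P (T - A ⊕ B)`, exactly the
operator whose trace norm is assumed to be `o(|Λ|)`. -/
theorem starProjection_mul_eq (A : K →L[ℂ] K) (B : Kᗮ →L[ℂ] Kᗮ) (T : E →L[ℂ] E) :
    K.starProjection * T = extendZero K A * K.starProjection +
      K.starProjection ∘L (T - blockSum K A B) := by
  ext x
  have h : K.starProjection (blockSum K A B x) = extendZero K A (K.starProjection x) := by
    have h1 : blockSum K A B x = (A (K.orthogonalProjectionOnto x) : E) +
      (B (Kᗮ.orthogonalProjectionOnto x) : E) := rfl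
    have h2 : extendZero K A (K.starProjection x) =
      (A (K.orthogonalProjectionOnto (K.orthogonalProjectionOnto x : E)) : E) := rfl
    rw [h1, h2, map_add, Submodule.starProjection_mem_subspace_eq_self,
      Submodule.orthogonalProjectionOnto_mem_subspace_eq_self, add_eq_left,
      Submodule.starProjection_apply, Submodule.coe_eq_zero,
      Submodule.orthogonalProjectionOnto_eq_zero_iff]
    exact (B _).2
  simp only [mul_apply_eq_comp, add_apply, ContinuousLinearMap.comp_apply, sub_apply, map_sub, h]
  abel

/-- Telescoping of the one-step identity: each factor `T` is in turn exchanged for `A ⊕ 0`. The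
natural subtraction `k - 1 - i` is harmless, as `i < k`. -/
theorem starProjection_mul_pow_eq (A : K →L[ℂ] K) (B : Kᗮ →L[ℂ] Kᗮ) (T : E →L[ℂ] E) (k : ℕ) :
    K.starProjection * T ^ k = extendZero K A ^ k * K.starProjection +
      ∑ i ∈ Finset.range k, extendZero K A ^ i *
        (K.starProjection ∘L (T - blockSum K A B)) * T ^ (k - 1 - i) := by
  induction k with
  | zero => simp
  | succ k ih =>
    have h : K.starProjection * T ^ (k + 1) = extendZero K A * (K.starProjection * T ^ k) +
        (K.starProjection ∘L (T - blockSum K A B)) * T ^ k := by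
      rw [pow_succ', ← mul_assoc, starProjection_mul_eq K A B T, add_mul, mul_assoc]
    rw [h, ih, mul_add, Finset.sum_range_succ', Finset.mul_sum, pow_succ', mul_assoc, add_assoc]
    congr 2
    refine Finset.sum_congr rfl fun i _ => ?_
    rw [pow_succ', show k + 1 - 1 - (i + 1) = k - 1 - i by omega]
    simp only [mul_assoc]

end FiniteVolume

/-! ### The orthonormal basis of a box and the finite volume estimate. -/

section Box

variable {d : ℕ}

theorem orthonormal_basisVec : Orthonormal ℂ (basisVec : Site d → Hil d) := by
  rw [orthonormal_iff_ite]
  intro i j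
  rw [inner_basisVec, basisVec, lp.single_apply, Pi.single_apply]

theorem basisVec_mem_boxSpace {Λ : Finset (Site d)} (j : Λ) : (basisVec j : Hil d) ∈ boxSpace Λ :=
  Submodule.subset_span ⟨j, j.2, rfl⟩

/-- The canonical orthonormal basis of `H_Λ`. -/
noncomputable def boxBasis (Λ : Finset (Site d)) : OrthonormalBasis Λ ℂ (boxSpace Λ) :=
  OrthonormalBasis.mkOfOrthogonalEqBot (v := fun j : Λ => ⟨basisVec j, basisVec_mem_boxSpace j⟩)
    (by
      rw [orthonormal_iff_ite]
      intro i j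
      have h := orthonormal_iff_ite.mp (orthonormal_basisVec (d := d)) i j
      exact h.trans (by simp only [Subtype.coe_inj]))
    (by
      rw [Submodule.eq_bot_iff]
      intro x hx
      have h : ∀ y ∈ boxSpace Λ, ⟪y, (x : Hil d)⟫_ℂ = 0 := by
        intro y hy
        induction hy using Submodule.span_induction with
        | mem y hy =>
          obtain ⟨j, hj, rfl⟩ := hy
          exact (Submodule.mem_orthogonal _ _).mp hx _ (Submodule.subset_span ⟨⟨j, hj⟩, rfl⟩)
        | zero => simp
        | add y z _ _ hy hz => rw [inner_add_left, hy, hz, add_zero]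
        | smul c y _ hy => rw [inner_smul_left, hy, mul_zero]
      exact Subtype.ext (inner_self_eq_zero.mp (h x x.2)))

theorem coe_boxBasis (Λ : Finset (Site d)) (j : Λ) :
    ((boxBasis Λ j : boxSpace Λ) : Hil d) = basisVec j := by
  rw [boxBasis, OrthonormalBasis.coe_of_orthogonal_eq_bot_mk]

theorem finrank_boxSpace (Λ : Finset (Site d)) : Module.finrank ℂ (boxSpace Λ) = Λ.card := by
  rw [Module.finrank_eq_card_basis (boxBasis Λ).toBasis, Fintype.card_coe]

/-- The finite volume estimate of the moments. -/
theorem norm_sum_moment_le (Λ : Finset (Site d)) {T : Hil d →L[ℂ] Hil d} (hT : ‖T‖ ≤ 1)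
    {A : boxSpace Λ →L[ℂ] boxSpace Λ} (hA : ‖A‖ ≤ 1) (B : (boxSpace Λ)ᗮ →L[ℂ] (boxSpace Λ)ᗮ)
    {r : ℝ≥0} (hr : spectralRadius ℂ A ≤ r)
    (htr : IsTraceClass ((boxSpace Λ).starProjection ∘L (T - blockSum (boxSpace Λ) A B)))
    (k : ℕ) :
    ‖∑ j ∈ Λ, ⟪basisVec j, (T ^ k) (basisVec j)⟫_ℂ‖ ≤ Λ.card * (r : ℝ) ^ k +
      k * (traceNorm ((boxSpace Λ).starProjection ∘L
        (T - blockSum (boxSpace Λ) A B))).toReal := by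
  have hexp := starProjection_mul_pow_eq (boxSpace Λ) A B T k
  generalize (boxSpace Λ).starProjection ∘L (T - blockSum (boxSpace Λ) A B) = D at htr hexp ⊢
  have hmem : ∀ j ∈ Λ, (basisVec j : Hil d) ∈ boxSpace Λ := fun j hj =>
    basisVec_mem_boxSpace ⟨j, hj⟩
  have hP : ∀ j ∈ Λ, (boxSpace Λ).starProjection (basisVec j : Hil d) = basisVec j := fun j hj =>
    Submodule.starProjection_eq_self_iff.mpr (hmem j hj)
  have h1 : ∀ j ∈ Λ, ⟪basisVec j, (T ^ k) (basisVec j)⟫_ℂ =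
      ⟪basisVec j, (extendZero (boxSpace Λ) A ^ k) (basisVec j)⟫_ℂ + ∑ i ∈ Finset.range k,
        ⟪basisVec j, (extendZero (boxSpace Λ) A ^ i * D * T ^ (k - 1 - i)) (basisVec j)⟫_ℂ := by
    intro j hj
    have e1 : ⟪basisVec j, (T ^ k) (basisVec j)⟫_ℂ =
        ⟪basisVec j, ((boxSpace Λ).starProjection * T ^ k) (basisVec j)⟫_ℂ := by
      rw [mul_apply_eq_comp, ← Submodule.inner_starProjection_left_eq_right, hP j hj]
    rw [e1, hexp, add_apply, mul_apply_eq_comp, hP j hj,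
      inner_add_right, sum_apply, inner_sum]
  -- Summing the diagonal over the basis of `H_Λ` gives the trace of `A ^ k`.
  have h2 : ∑ j ∈ Λ, ⟪basisVec j, (extendZero (boxSpace Λ) A ^ k) (basisVec j)⟫_ℂ =
      LinearMap.trace ℂ (boxSpace Λ)
        ((A ^ k : boxSpace Λ →L[ℂ] boxSpace Λ) : boxSpace Λ →ₗ[ℂ] boxSpace Λ) := by
    rw [LinearMap.trace_eq_sum_inner _ (boxBasis Λ), ← Finset.sum_coe_sort]
    refine Finset.sum_congr rfl fun j _ => ?_
    rw [Submodule.coe_inner, coe_boxBasis, ← coe_boxBasis Λ j, extendZero_pow_apply]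
    rfl
  rw [Finset.sum_congr rfl h1, Finset.sum_add_distrib, h2, Finset.sum_comm]
  refine (norm_add_le _ _).trans (add_le_add ?_ ?_)
  · rw [← finrank_boxSpace]
    exact norm_trace_pow_le A hr k
  · refine (norm_sum_le _ _).trans ?_
    refine (Finset.sum_le_card_nsmul _ _ _ fun i _ => norm_sum_inner_le_traceNorm htr ?_ ?_ Λ).trans
      ?_
    · simpa using norm_pow_le_of_le (norm_extendZero_le _ hA) i
    · simpa using norm_pow_le_of_le hT (k - 1 - i)
    · simp

end Box

/-! ### The lattice -/

section Lattice

variable {d : ℕ} {γ : Fin d → Site d}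

theorem zero_mem_cell (γ : Fin d → Site d) : (0 : Site d) ∈ cell γ := by
  rw [cell, Set.Finite.mem_toFinset]
  exact ⟨0, fun i => ⟨le_rfl, one_pos⟩, fun k => by simp⟩

/-- Integral vectors that are independent over `ℤ` are independent over `ℝ`. -/
theorem eq_zero_of_sum_mul_eq_zero (hγ : LinearIndependent ℤ γ) {x : Fin d → ℝ}
    (hx : ∀ k, ∑ i, x i * (γ i k : ℝ) = 0) : x = 0 := by
  -- Independence over `ℤ` makes the integer determinant nonzero, and this survives the cast to `ℝ`.
  have hdet : (Matrix.of γ).det ≠ 0 := by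
    intro h
    obtain ⟨v, hv0, hv⟩ := Matrix.exists_vecMul_eq_zero_iff.mpr h
    refine hv0 (funext fun i => Fintype.linearIndependent_iff.mp hγ v ?_ i)
    funext k
    have := congrFun hv k
    simpa [Matrix.vecMul, dotProduct] using this
  have hdet' : ((Matrix.of γ).map (Int.cast : ℤ → ℝ)).det ≠ 0 := by
    rw [show (Matrix.of γ).map (Int.cast : ℤ → ℝ) = (Int.castRingHom ℝ).mapMatrix (Matrix.of γ)
      from rfl, ← RingHom.map_det]
    simpa using hdet
  refine Matrix.eq_zero_of_vecMul_eq_zero hdet' (funext fun k => ?_)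
  simpa [Matrix.vecMul, dotProduct] using hx k

/-- The translates of the cell are disjoint: real coordinates with respect to `γ` are unique, and
two integers whose difference is that of numbers in `[0, 1)` coincide. -/
theorem cell_add_injective (hγ : LinearIndependent ℤ γ) {b b' : Site d} (hb : b ∈ cell γ)
    (hb' : b' ∈ cell γ) {n n' : Fin d → ℤ}
    (h : b + ∑ i, n i • γ i = b' + ∑ i, n' i • γ i) : b = b' ∧ n = n' := by
  rw [cell, Set.Finite.mem_toFinset] at hb hb'
  obtain ⟨x, hx, hxb⟩ := hb
  obtain ⟨x', hx', hxb'⟩ := hb'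
  have h0 : (fun i => x i + n i - (x' i + n' i)) = (0 : Fin d → ℝ) := by
    refine eq_zero_of_sum_mul_eq_zero hγ fun k => ?_
    have hk := congrFun h k
    simp only [Pi.add_apply, Finset.sum_apply, Pi.smul_apply, smul_eq_mul] at hk
    have hk' : (b k : ℝ) + ∑ i, (n i : ℝ) * γ i k = b' k + ∑ i, (n' i : ℝ) * γ i k := by
      exact_mod_cast hk
    rw [hxb, hxb', ← Finset.sum_add_distrib, ← Finset.sum_add_distrib, ← sub_eq_zero,
      ← Finset.sum_sub_distrib] at hk'
    rw [← hk']
    exact Finset.sum_congr rfl fun i _ => by ring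
  have hn : n = n' := by
    funext i
    have hi := congrFun h0 i
    simp only [Pi.zero_apply] at hi
    have h1 : (n i : ℝ) - n' i < 1 := by linarith [(hx i).1, (hx' i).2]
    have h2 : (n' i : ℝ) - n i < 1 := by linarith [(hx i).2, (hx' i).1]
    have h1' : n i - n' i < 1 := by exact_mod_cast h1
    have h2' : n' i - n i < 1 := by exact_mod_cast h2
    omega
  subst hn
  exact ⟨add_right_cancel h, rfl⟩

theorem sum_box (hγ : LinearIndependent ℤ γ) (n : ℕ) {M : Type*} [AddCommMonoid M]
    (m : Site d → M) :
    ∑ j ∈ box γ n, m j = ∑ p ∈ cell γ ×ˢ Fintype.piFinset fun _ : Fin d =>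
      Finset.Icc (-(n : ℤ)) n, m (p.1 + ∑ i, p.2 i • γ i) := by
  rw [box, Finset.sum_image]
  rintro ⟨b, k⟩ hp ⟨b', k'⟩ hp' h
  simp only [Finset.coe_product, Set.mem_prod, Finset.mem_coe] at hp hp'
  obtain ⟨h1, h2⟩ := cell_add_injective hγ hp.1 hp'.1 h
  exact Prod.ext h1 h2

theorem card_box_pos (γ : Fin d → Site d) (n : ℕ) : 0 < (box γ n).card := by
  refine Finset.card_pos.mpr ⟨0, Finset.mem_image.mpr ⟨(0, 0), ?_, by simp⟩⟩
  rw [Finset.mem_product]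
  exact ⟨zero_mem_cell γ, Fintype.mem_piFinset.mpr fun i => by simp⟩

/-- The mean over a box of a function that is invariant under the lattice. -/
theorem mean_box_eq_mean_cell (hγ : LinearIndependent ℤ γ) (n : ℕ) (m : Site d → ℂ)
    (hm : ∀ b, ∀ g ∈ lattice γ, m (b + g) = m b) :
    ((box γ n).card : ℂ)⁻¹ * ∑ j ∈ box γ n, m j = ((cell γ).card : ℂ)⁻¹ * ∑ b ∈ cell γ, m b := by
  set I := Fintype.piFinset fun _ : Fin d => Finset.Icc (-(n : ℤ)) n with hI
  have hcard : (box γ n).card = (cell γ).card * I.card := by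
    have h := sum_box hγ n (fun _ => (1 : ℕ))
    rwa [Finset.sum_const, Finset.sum_const, smul_eq_mul, mul_one, smul_eq_mul, mul_one,
      Finset.card_product] at h
  have hIpos : 0 < I.card := by
    have := card_box_pos γ n
    rw [hcard] at this
    exact Nat.pos_of_mul_pos_left this
  have hI0 : (I.card : ℂ) ≠ 0 := by exact_mod_cast hIpos.ne'
  have hsum : ∑ j ∈ box γ n, m j = I.card * ∑ b ∈ cell γ, m b := by
    rw [sum_box hγ, Finset.sum_product, Finset.mul_sum]
    refine Finset.sum_congr rfl fun b _ => ?_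
    rw [Finset.sum_congr rfl fun k _ => hm b _ ?_, Finset.sum_const, nsmul_eq_mul]
    exact Submodule.sum_mem _ fun i _ =>
      Submodule.smul_mem _ _ (Submodule.subset_span (Set.mem_range_self i))
  rw [hsum, hcard]
  push_cast
  field_simp

end Lattice

/-! ### Moments of the random operator -/

section Moments

variable {d : ℕ} {X : Set ℝ}

theorem measurable_shift (g : Site d) : Measurable (shift g : Sample d X → Sample d X) :=
  measurable_pi_lambda _ fun k => measurable_pi_apply (k + g)

/-- All factors are equal, so relabelling the sites changes nothing; it is enough to compare
cylinders, whose preimages are cylinders over translated sites. -/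
theorem map_shift_prodMeasure (μ : Measure X) [IsProbabilityMeasure μ] (g : Site d) :
    (prodMeasure d μ).map (shift g) = prodMeasure d μ := by
  refine Measure.eq_infinitePi _ fun s t ht => ?_
  rw [Measure.map_apply (measurable_shift g) (MeasurableSet.pi s.countable_toSet fun i _ => ht i)]
  have h : (shift g : Sample d X → Sample d X) ⁻¹' (s : Set (Site d)).pi t =
      ((s.map (Equiv.addRight g).toEmbedding : Finset (Site d)) : Set (Site d)).pi
        fun i => t (i - g) := by
    ext ω
    simp only [shift, Set.mem_preimage, Set.mem_pi, Finset.mem_coe, Finset.mem_map_equiv]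
    refine ⟨fun h i hi => ?_, fun h i hi => ?_⟩
    · simpa using h (i - g) (by simpa [sub_eq_add_neg] using hi)
    · simpa using h (i + g) (by simpa using hi)
  rw [h, prodMeasure, Measure.infinitePi_pi _ fun i _ => ht (i - g), Finset.prod_map]
  simp

instance (μ : Measure X) [IsProbabilityMeasure μ] : IsProbabilityMeasure (prodMeasure d μ) := by
  unfold prodMeasure
  infer_instance

theorem hasSum_coord_mul_inner (x y : Hil d) :
    HasSum (fun k => ⟪x, basisVec k⟫_ℂ * ⟪basisVec k, y⟫_ℂ) ⟪x, y⟫_ℂ := by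
  refine (lp.hasSum_inner x y).congr_fun fun k => ?_
  rw [← inner_conj_symm x, inner_basisVec, inner_basisVec]
  simp [mul_comm]

variable {T : Sample d X → Hil d →L[ℂ] Hil d}

/-- Expanding in the canonical basis between `T` and `Tⁿ` writes the matrix element as a countable
sum of products of measurable ones. -/
theorem measurable_inner_pow (hT : ∀ x y : Hil d, Measurable fun ω => ⟪x, T ω y⟫_ℂ) (n : ℕ)
    (x y : Hil d) : Measurable fun ω => ⟪x, (T ω ^ n) y⟫_ℂ := by
  induction n generalizing x y with
  | zero => simp
  | succ n ih =>
    refine measurable_of_tendsto_metrizable' (atTop : Filter (Finset (Site d)))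
      (f := fun s ω => ∑ k ∈ s, ⟪x, T ω (basisVec k)⟫_ℂ * ⟪basisVec k, (T ω ^ n) y⟫_ℂ)
      (fun s => Finset.measurable_sum _ fun k _ => (hT x _).mul (ih _ _))
      (tendsto_pi_nhds.mpr fun ω => ?_)
    have h := hasSum_coord_mul_inner (ContinuousLinearMap.adjoint (T ω) x) ((T ω ^ n) y)
    simp only [ContinuousLinearMap.adjoint_inner_left] at h
    rw [← mul_apply_eq_comp, ← pow_succ'] at h
    exact h

theorem norm_inner_pow_le {A : Hil d →L[ℂ] Hil d} (hA : ‖A‖ ≤ 1) (n : ℕ) (j : Site d) :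
    ‖⟪basisVec j, (A ^ n) (basisVec j)⟫_ℂ‖ ≤ 1 := by
  refine (norm_inner_le_norm _ _).trans ?_
  have h := norm_pow_apply_le hA n (basisVec j : Hil d)
  simpa [norm_basisVec] using h

theorem integrable_inner_pow (μ : Measure X) [IsProbabilityMeasure μ]
    (hT : ∀ x y : Hil d, Measurable fun ω => ⟪x, T ω y⟫_ℂ) (hT1 : ∀ ω, ‖T ω‖ ≤ 1) (n : ℕ)
    (j : Site d) :
    Integrable (fun ω => ⟪basisVec j, (T ω ^ n) (basisVec j)⟫_ℂ) (prodMeasure d μ) :=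
  Integrable.of_bound (measurable_inner_pow hT n _ _).aestronglyMeasurable 1
    (ae_of_all _ fun ω => norm_inner_pow_le (hT1 ω) n j)

theorem pow_shift_apply {γ : Fin d → Site d}
    (hT : ∀ g ∈ lattice γ, ∀ ω x,
      T (shift g ω) x = translation g (T ω ((translation g).symm x)))
    {g : Site d} (hg : g ∈ lattice γ) (ω : Sample d X) (n : ℕ) (x : Hil d) :
    (T (shift g ω) ^ n) x = translation g ((T ω ^ n) ((translation g).symm x)) := by
  induction n with
  | zero => simp
  | succ n ih =>
    rw [pow_succ', mul_apply_eq_comp, ih, hT g hg, LinearIsometryEquiv.symm_apply_apply, pow_succ',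
      mul_apply_eq_comp]

/-- `V_g φ_{b+g} = φ_b`, so covariance trades the translation of the site for a shift of `ω`, which
preserves the measure. -/
theorem integral_moment_add (μ : Measure X) [IsProbabilityMeasure μ] {γ : Fin d → Site d}
    (hTm : ∀ x y : Hil d, Measurable fun ω => ⟪x, T ω y⟫_ℂ)
    (hT : ∀ g ∈ lattice γ, ∀ ω x,
      T (shift g ω) x = translation g (T ω ((translation g).symm x)))
    (n : ℕ) (b : Site d) {g : Site d} (hg : g ∈ lattice γ) :
    ∫ ω, ⟪basisVec (b + g), (T ω ^ n) (basisVec (b + g))⟫_ℂ ∂(prodMeasure d μ) =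
      ∫ ω, ⟪basisVec b, (T ω ^ n) (basisVec b)⟫_ℂ ∂(prodMeasure d μ) := by
  have hV : (basisVec b : Hil d) = translation g (basisVec (b + g)) := by
    rw [translation_basisVec, add_sub_cancel_right]
  conv_rhs => rw [← map_shift_prodMeasure μ g]
  rw [integral_map (measurable_shift g).aemeasurable
    (measurable_inner_pow hTm n _ _).aestronglyMeasurable]
  refine integral_congr_ae (ae_of_all _ fun ω => ?_)
  change _ = ⟪basisVec b, (T (shift g ω) ^ n) (basisVec b)⟫_ℂ
  rw [pow_shift_apply hT hg, hV, LinearIsometryEquiv.symm_apply_apply,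
    LinearIsometryEquiv.inner_map_map]

/-- The moments `|B|⁻¹ ∑_{b ∈ B} 𝔼 ⟨φ_b, T_ωⁿ φ_b⟩`. -/
noncomputable def moment (μ : Measure X) (γ : Fin d → Site d)
    (T : Sample d X → Hil d →L[ℂ] Hil d) (n : ℕ) : ℂ :=
  ((cell γ).card : ℂ)⁻¹ *
    ∑ b ∈ cell γ, ∫ ω, ⟪basisVec b, (T ω ^ n) (basisVec b)⟫_ℂ ∂(prodMeasure d μ)

/-- The cell average may be replaced by the average over any box, so the finite volume estimate
applies for every `n`. -/
theorem moment_eq_integral_box (μ : Measure X) [IsProbabilityMeasure μ] {γ : Fin d → Site d}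
    (hγ : LinearIndependent ℤ γ)
    (hTm : ∀ x y : Hil d, Measurable fun ω => ⟪x, T ω y⟫_ℂ) (hT1 : ∀ ω, ‖T ω‖ ≤ 1)
    (hT : ∀ g ∈ lattice γ, ∀ ω x,
      T (shift g ω) x = translation g (T ω ((translation g).symm x)))
    (k n : ℕ) :
    moment μ γ T k = ∫ ω, ((box γ n).card : ℂ)⁻¹ *
      ∑ j ∈ box γ n, ⟪basisVec j, (T ω ^ k) (basisVec j)⟫_ℂ ∂(prodMeasure d μ) := by
  rw [integral_const_mul, integral_finsetSum _ fun j _ => integrable_inner_pow μ hTm hT1 k j,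
    mean_box_eq_mean_cell hγ n
      (fun j => ∫ ω, ⟪basisVec j, (T ω ^ k) (basisVec j)⟫_ℂ ∂(prodMeasure d μ))
      fun b g hg => integral_moment_add μ hTm hT k b hg]
  rfl

/-- The moments decay geometrically. -/
theorem norm_moment_le (μ : Measure X) [IsProbabilityMeasure μ] {γ : Fin d → Site d}
    (hγ : LinearIndependent ℤ γ)
    (hTm : ∀ x y : Hil d, Measurable fun ω => ⟪x, T ω y⟫_ℂ) (hT1 : ∀ ω, ‖T ω‖ ≤ 1)
    (hT : ∀ g ∈ lattice γ, ∀ ω x,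
      T (shift g ω) x = translation g (T ω ((translation g).symm x)))
    (TΛ : ∀ n : ℕ, Sample d X → boxSpace (box γ n) →L[ℂ] boxSpace (box γ n))
    (TΛc : ∀ n : ℕ, Sample d X → (boxSpace (box γ n))ᗮ →L[ℂ] (boxSpace (box γ n))ᗮ)
    (hΛ1 : ∀ n ω, ‖TΛ n ω‖ ≤ 1)
    (hΛ : ∀ ω, Tendsto
      (fun n : ℕ => traceNorm ((boxSpace (box γ n)).starProjection ∘L
          (T ω - blockSum (boxSpace (box γ n)) (TΛ n ω) (TΛc n ω))) /
        ((box γ n).card : ℝ≥0∞)) atTop (𝓝 0))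
    {r : ℝ≥0} (hr : ∀ n ω, spectralRadius ℂ (TΛ n ω) ≤ r) (hr1 : r ≤ 1) (k : ℕ) :
    ‖moment μ γ T k‖ ≤ (r : ℝ) ^ k := by
  set x : ℕ → Sample d X → ℂ := fun n ω => ((box γ n).card : ℂ)⁻¹ *
      ∑ j ∈ box γ n, ⟪basisVec j, (T ω ^ k) (basisVec j)⟫_ℂ with hx
  have hcard : ∀ n, (0 : ℝ) < (box γ n).card := fun n => by exact_mod_cast card_box_pos γ n
  have hxnorm : ∀ n ω, ‖x n ω‖ = ((box γ n).card : ℝ)⁻¹ *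
      ‖∑ j ∈ box γ n, ⟪basisVec j, (T ω ^ k) (basisVec j)⟫_ℂ‖ := fun n ω => by simp [hx]
  have hx1 : ∀ n ω, ‖x n ω‖ ≤ 1 := by
    intro n ω
    rw [hxnorm, inv_mul_le_iff₀ (hcard n), mul_one]
    refine (norm_sum_le _ _).trans ?_
    refine (Finset.sum_le_card_nsmul _ _ 1 fun j _ => norm_inner_pow_le (hT1 ω) k j).trans ?_
    simp
  have hxm : ∀ n, Measurable (x n) := fun n =>
    (Finset.measurable_sum _ fun j _ => measurable_inner_pow hTm k _ _).const_mul _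
  have hrk : (r : ℝ) ^ k ≤ 1 := pow_le_one₀ r.2 (by exact_mod_cast hr1)
  -- The maximum is squeezed between `r^k` and `r^k + k ‖D‖₁ / |Λ|`, hence converges. It is
  -- measurable and at most one, so dominated convergence needs no measurability of the trace norm.
  have hlim : ∀ ω, Tendsto (fun n => max ‖x n ω‖ ((r : ℝ) ^ k)) atTop (𝓝 ((r : ℝ) ^ k)) := by
    intro ω
    have h1 := (ENNReal.tendsto_toReal ENNReal.zero_ne_top).comp (hΛ ω)
    have h2 := (h1.const_mul (k : ℝ)).const_add ((r : ℝ) ^ k)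
    simp only [ENNReal.toReal_zero, mul_zero, add_zero] at h2
    refine tendsto_of_tendsto_of_tendsto_of_le_of_le' tendsto_const_nhds h2
      (Eventually.of_forall fun n => le_max_right _ _) ?_
    -- A quotient tending to zero is eventually finite, which forces the compressed difference to be
    -- trace class.
    filter_upwards [(hΛ ω).eventually (gt_mem_nhds ENNReal.zero_lt_top)] with n hn
    have htc : IsTraceClass ((boxSpace (box γ n)).starProjection ∘L
        (T ω - blockSum (boxSpace (box γ n)) (TΛ n ω) (TΛc n ω))) := by
      by_contra hcon
      have htop : traceNorm ((boxSpace (box γ n)).starProjection ∘L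
        (T ω - blockSum (boxSpace (box γ n)) (TΛ n ω) (TΛc n ω))) = ∞ := not_lt_top_iff.mp hcon
      rw [htop, ENNReal.top_div_of_ne_top (ENNReal.natCast_ne_top _)] at hn
      exact lt_irrefl _ hn
    have h3 := norm_sum_moment_le (box γ n) (hT1 ω) (hΛ1 n ω) (TΛc n ω) (hr n ω) htc k
    refine max_le ?_ (le_add_of_nonneg_right
      (mul_nonneg k.cast_nonneg ENNReal.toReal_nonneg))
    rw [hxnorm, inv_mul_le_iff₀ (hcard n)]
    refine h3.trans_eq ?_
    rw [Function.comp_apply, ENNReal.toReal_div, ENNReal.toReal_natCast]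
    have := (hcard n).ne'
    field_simp
  have hint := tendsto_integral_of_dominated_convergence (μ := prodMeasure d μ) (fun _ => (1 : ℝ))
    (F := fun n ω => max ‖x n ω‖ ((r : ℝ) ^ k)) (f := fun _ => (r : ℝ) ^ k)
    (fun n => ((hxm n).norm.max measurable_const).aestronglyMeasurable) (integrable_const _)
    (fun n => ae_of_all _ fun ω => by
      rw [Real.norm_of_nonneg (le_max_of_le_left (norm_nonneg _))]
      exact max_le (hx1 n ω) hrk)
    (ae_of_all _ hlim)
  rw [integral_const] at hint
  simp only [probReal_univ, one_smul] at hint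
  refine ge_of_tendsto' hint fun n => ?_
  rw [moment_eq_integral_box μ hγ hTm hT1 hT k n]
  refine (norm_integral_le_integral_norm _).trans ?_
  refine integral_mono_of_nonneg (ae_of_all _ fun ω => norm_nonneg _) ?_
    (ae_of_all _ fun ω => le_max_left _ _)
  exact Integrable.of_bound ((hxm n).norm.max measurable_const).aestronglyMeasurable 1
    (ae_of_all _ fun ω => by
      rw [Real.norm_of_nonneg (le_max_of_le_left (norm_nonneg _))]
      exact max_le (hx1 n ω) hrk)

end Moments

/-! ### The density of states functional in terms of the moments -/

section Functional

variable {d : ℕ} {X : Set ℝ} {T : Sample d X → Hil d →L[ℂ] Hil d}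

theorem measurable_inner_calcAbel (hT : ∀ x y : Hil d, Measurable fun ω => ⟪x, T ω y⟫_ℂ)
    (hT1 : ∀ ω, ‖T ω‖ ≤ 1) {f : ℂ → ℂ} (hf : DiskAlgebra f) {ρ : ℝ} (h0 : 0 ≤ ρ) (h1 : ρ < 1)
    (x y : Hil d) : Measurable fun ω => ⟪x, calcAbel (T ω) f ρ y⟫_ℂ := by
  refine measurable_of_tendsto_metrizable' (atTop : Filter (Finset ℕ))
    (f := fun s ω => ∑ n ∈ s, taylorCoeff f n * (ρ : ℂ) ^ n * ⟪x, (T ω ^ n) y⟫_ℂ)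
    (fun s => Finset.measurable_sum _ fun n _ => (measurable_inner_pow hT n x y).const_mul _)
    (tendsto_pi_nhds.mpr fun ω => ?_)
  exact hf.hasSum_inner_calcAbel (hT1 ω) h0 h1 x y

theorem eventually_mem_Ico : ∀ᶠ ρ : ℝ in 𝓝[<] 1, 0 ≤ ρ ∧ ρ < 1 := by
  filter_upwards [Ioo_mem_nhdsLT (zero_lt_one' ℝ)] with ρ hρ
  exact ⟨hρ.1.le, hρ.2⟩

theorem DiskAlgebra.tendsto_inner_calcAbel {f : ℂ → ℂ} (hf : DiskAlgebra f)
    {A : Hil d →L[ℂ] Hil d} (hA : ‖A‖ ≤ 1) (x y : Hil d) :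
    Tendsto (fun ρ : ℝ => ⟪x, calcAbel A f ρ y⟫_ℂ) (𝓝[<] 1) (𝓝 ⟪x, funcCalc A f y⟫_ℂ) :=
  tendsto_const_nhds.inner (hf.tendsto_calcAbel_apply hA y)

theorem measurable_inner_funcCalc (hT : ∀ x y : Hil d, Measurable fun ω => ⟪x, T ω y⟫_ℂ)
    (hT1 : ∀ ω, ‖T ω‖ ≤ 1) {f : ℂ → ℂ} (hf : DiskAlgebra f) (x y : Hil d) :
    Measurable fun ω => ⟪x, funcCalc (T ω) f y⟫_ℂ := by
  classical
  refine measurable_of_tendsto_metrizable' (𝓝[<] (1 : ℝ))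
    -- The cut-off makes every member of the family measurable and is invisible to the limit `ρ →
    -- 1⁻`.
    (f := fun ρ ω => if 0 ≤ ρ ∧ ρ < 1 then ⟪x, calcAbel (T ω) f ρ y⟫_ℂ else 0)
    (fun ρ => ?_) (tendsto_pi_nhds.mpr fun ω => ?_)
  · by_cases h : 0 ≤ ρ ∧ ρ < 1
    · simpa only [h, and_self, if_true] using measurable_inner_calcAbel hT hT1 hf h.1 h.2 x y
    · simp only [h, if_false, measurable_const]
  · refine (hf.tendsto_inner_calcAbel (hT1 ω) x y).congr' ?_
    filter_upwards [eventually_mem_Ico] with ρ hρ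
    rw [if_pos hρ]

theorem norm_inner_basisVec_le {A : Hil d →L[ℂ] Hil d} {M : ℝ} (hA : ‖A‖ ≤ M) (b : Site d) :
    ‖⟪basisVec b, A (basisVec b)⟫_ℂ‖ ≤ M := by
  refine (norm_inner_le_norm _ _).trans ?_
  have h := A.le_of_opNorm_le hA (basisVec b : Hil d)
  rw [norm_basisVec] at h ⊢
  linarith

theorem integrable_inner_funcCalc (μ : Measure X) [IsProbabilityMeasure μ]
    (hT : ∀ x y : Hil d, Measurable fun ω => ⟪x, T ω y⟫_ℂ)
    (hT1 : ∀ ω, ‖T ω‖ ≤ 1) {f : ℂ → ℂ} (hf : DiskAlgebra f) (b : Site d) :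
    Integrable (fun ω => ⟪basisVec b, funcCalc (T ω) f (basisVec b)⟫_ℂ) (prodMeasure d μ) := by
  obtain ⟨M, -, hM⟩ := hf.exists_bound
  refine Integrable.of_bound (measurable_inner_funcCalc hT hT1 hf _ _).aestronglyMeasurable M
    (ae_of_all _ fun ω => ?_)
  refine le_of_tendsto (hf.tendsto_inner_calcAbel (hT1 ω) _ _).norm ?_
  filter_upwards [eventually_mem_Ico] with ρ hρ
  exact norm_inner_basisVec_le (hf.norm_calcAbel_le (hT1 ω) hρ.1 hρ.2 hM) b

theorem hasSum_integral_calcAbel (μ : Measure X) [IsProbabilityMeasure μ]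
    (hT : ∀ x y : Hil d, Measurable fun ω => ⟪x, T ω y⟫_ℂ) (hT1 : ∀ ω, ‖T ω‖ ≤ 1)
    {f : ℂ → ℂ} (hf : DiskAlgebra f) {ρ : ℝ} (h0 : 0 ≤ ρ) (h1 : ρ < 1) (b : Site d) :
    HasSum (fun n => taylorCoeff f n * (ρ : ℂ) ^ n *
        ∫ ω, ⟪basisVec b, (T ω ^ n) (basisVec b)⟫_ℂ ∂(prodMeasure d μ))
      (∫ ω, ⟪basisVec b, calcAbel (T ω) f ρ (basisVec b)⟫_ℂ ∂(prodMeasure d μ)) := by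
  have h := hasSum_integral_of_dominated_convergence (μ := prodMeasure d μ)
    (F := fun n ω => taylorCoeff f n * (ρ : ℂ) ^ n * ⟪basisVec b, (T ω ^ n) (basisVec b)⟫_ℂ)
    (f := fun ω => ⟪basisVec b, calcAbel (T ω) f ρ (basisVec b)⟫_ℂ)
    (fun n _ => ‖taylorCoeff f n * (ρ : ℂ) ^ n‖)
    (fun n => ((measurable_inner_pow hT n _ _).const_mul _).aestronglyMeasurable)
    (fun n => ae_of_all _ fun ω => ?_) (ae_of_all _ fun _ => hf.summable_norm h0 h1)
    (integrable_const _)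
    (ae_of_all _ fun ω => hf.hasSum_inner_calcAbel (hT1 ω) h0 h1 _ _)
  · simpa only [integral_const_mul] using h
  · rw [norm_mul]
    exact mul_le_of_le_one_right (norm_nonneg _) (norm_inner_pow_le (hT1 ω) n b)

/-- `L(f) = ∑ aₙ L(zⁿ)`. -/
theorem hasSum_dos (μ : Measure X) [IsProbabilityMeasure μ] (γ : Fin d → Site d)
    (hT : ∀ x y : Hil d, Measurable fun ω => ⟪x, T ω y⟫_ℂ) (hT1 : ∀ ω, ‖T ω‖ ≤ 1)
    {r : ℝ} (hr0 : 0 ≤ r) (hr1 : r < 1) (hm : ∀ n, ‖moment μ γ T n‖ ≤ r ^ n) {f : ℂ → ℂ}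
    (hf : DiskAlgebra f) :
    HasSum (fun n => taylorCoeff f n * moment μ γ T n) (dos μ γ T f) := by
  obtain ⟨M, hM0, hM⟩ := hf.exists_bound
  obtain ⟨C, hC⟩ := hf.norm_taylorCoeff_le
  have hC0 : 0 ≤ C := (norm_nonneg _).trans (hC 0)
  have hgeo : Summable fun n : ℕ => C * r ^ n := (summable_geometric_of_lt_one hr0 hr1).mul_left C
  have hbound : ∀ n, ‖taylorCoeff f n * moment μ γ T n‖ ≤ C * r ^ n := fun n => by
    rw [norm_mul]
    exact mul_le_mul (hC n) (hm n) (norm_nonneg _) hC0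
  have hsum : Summable fun n => taylorCoeff f n * moment μ γ T n :=
    Summable.of_norm_bounded hgeo hbound
  -- Dominated convergence in `ω`; von Neumann's inequality supplies the constant `M`.
  have h1 : Tendsto (fun ρ : ℝ => ((cell γ).card : ℂ)⁻¹ * ∑ b ∈ cell γ,
      ∫ ω, ⟪basisVec b, calcAbel (T ω) f ρ (basisVec b)⟫_ℂ ∂(prodMeasure d μ)) (𝓝[<] 1)
      (𝓝 (dos μ γ T f)) := by
    refine Tendsto.const_mul _ (tendsto_finsetSum _ fun b _ => ?_)
    refine tendsto_integral_filter_of_dominated_convergence (fun _ => M) ?_ ?_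
      (integrable_const _) (ae_of_all _ fun ω => hf.tendsto_inner_calcAbel (hT1 ω) _ _)
    · filter_upwards [eventually_mem_Ico] with ρ hρ
      exact (measurable_inner_calcAbel hT hT1 hf hρ.1 hρ.2 _ _).aestronglyMeasurable
    · filter_upwards [eventually_mem_Ico] with ρ hρ
      exact ae_of_all _ fun ω =>
        norm_inner_basisVec_le (hf.norm_calcAbel_le (hT1 ω) hρ.1 hρ.2 hM) b
  -- Dominated convergence in `n`; bounded coefficients and decaying moments supply `C r^n`.
  have h2 : Tendsto (fun ρ : ℝ => ∑' n, taylorCoeff f n * (ρ : ℂ) ^ n * moment μ γ T n) (𝓝[<] 1)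
      (𝓝 (∑' n, taylorCoeff f n * moment μ γ T n)) := by
    refine tendsto_tsum_of_dominated_convergence hgeo (fun n => ?_) ?_
    · simpa using ((tendsto_ofReal_pow n).const_mul (taylorCoeff f n)).mul_const (moment μ γ T n)
    · filter_upwards [eventually_mem_Ico] with ρ hρ n
      refine le_trans ?_ (hbound n)
      rw [mul_right_comm, norm_mul]
      refine mul_le_of_le_one_right (norm_nonneg _) ?_
      rw [norm_pow, Complex.norm_real, Real.norm_of_nonneg hρ.1]
      exact pow_le_one₀ hρ.1 hρ.2.le
  have h3 : dos μ γ T f = ∑' n, taylorCoeff f n * moment μ γ T n := by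
    refine tendsto_nhds_unique h1 (h2.congr' ?_)
    filter_upwards [eventually_mem_Ico] with ρ hρ
    have h4 := (hasSum_sum fun b (_ : b ∈ cell γ) =>
      hasSum_integral_calcAbel μ hT hT1 hf hρ.1 hρ.2 b).mul_left ((cell γ).card : ℂ)⁻¹
    refine Eq.trans ?_ h4.tsum_eq
    refine tsum_congr fun n => ?_
    rw [moment, ← Finset.mul_sum]
    ring
  rw [h3]
  exact hsum.hasSum

end Functional

/-! ### Power series on the dilated disk -/

section DilatedDisk

variable {r : ℝ≥0}

theorem isOpen_dilatedDisk (r : ℝ≥0) : IsOpen (dilatedDisk r) :=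
  isOpen_lt (by fun_prop) continuous_const

theorem closedBall_subset_dilatedDisk (hr : r < 1) : Metric.closedBall 0 1 ⊆ dilatedDisk r := by
  intro z hz
  have hz1 : ‖z‖ ≤ 1 := by simpa using hz
  have hr1 : (r : ℝ) < 1 := by exact_mod_cast hr
  have hr0 : (0 : ℝ) ≤ r := r.2
  change (r : ℝ) * ‖z‖ < 1
  nlinarith

/-- Every point of the dilated disk lies in a ball about the origin whose radius is admissible. -/
theorem exists_ball_subset_dilatedDisk {z : ℂ} (hz : z ∈ dilatedDisk r) :
    ∃ R : ℝ, z ∈ Metric.ball (0 : ℂ) R ∧ (r : ℝ) * R < 1 ∧ Metric.ball 0 R ⊆ dilatedDisk r := by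
  have hz' : (r : ℝ) * ‖z‖ < 1 := hz
  have hcont : Tendsto (fun R : ℝ => (r : ℝ) * R) (𝓝[>] ‖z‖) (𝓝 ((r : ℝ) * ‖z‖)) :=
    (Continuous.tendsto (by fun_prop) _).mono_left nhdsWithin_le_nhds
  obtain ⟨R, hR1, hR2⟩ := ((hcont.eventually (gt_mem_nhds hz')).and self_mem_nhdsWithin).exists
  refine ⟨R, by simpa using hR2, hR1, fun w hw => ?_⟩
  have hw' : ‖w‖ < R := by simpa using hw
  exact (mul_le_mul_of_nonneg_left hw'.le r.2).trans_lt hR1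

theorem diskAlgebra_of_dilatedDisk (hr : r < 1) {ψ : ℂ → ℂ}
    (hψ : DifferentiableOn ℂ ψ (dilatedDisk r)) : DiskAlgebra ψ := by
  refine ⟨hψ.mono (Metric.ball_subset_closedBall.trans (closedBall_subset_dilatedDisk hr)), ?_⟩
  rw [closure_ball _ one_ne_zero]
  exact hψ.continuousOn.mono (closedBall_subset_dilatedDisk hr)

theorem hasSum_taylorCoeff_dilatedDisk {ψ : ℂ → ℂ} (hψ : DifferentiableOn ℂ ψ (dilatedDisk r))
    {z : ℂ} (hz : z ∈ dilatedDisk r) : HasSum (fun n => taylorCoeff ψ n * z ^ n) (ψ z) := by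
  obtain ⟨R, hzR, -, hR⟩ := exists_ball_subset_dilatedDisk hz
  exact hasSum_taylorCoeff (hψ.mono hR) hzR

theorem summable_norm_taylorCoeff (hr : r < 1) {ψ : ℂ → ℂ}
    (hψ : DifferentiableOn ℂ ψ (dilatedDisk r)) : Summable fun n => ‖taylorCoeff ψ n‖ := by
  have h := (hasSum_taylorCoeff_dilatedDisk hψ
    (closedBall_subset_dilatedDisk hr (by simp : (1 : ℂ) ∈ Metric.closedBall 0 1))).summable.norm
  simpa using h

/-- On a ball of radius `R` with `r R < 1` the geometric series `(r R)ⁿ` dominates. Arguing ball by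
ball also covers `r = 0`, where the domain is the plane. -/
theorem differentiableOn_tsum_pow {b : ℕ → ℂ} (hb : ∀ n, ‖b n‖ ≤ (r : ℝ) ^ n) :
    DifferentiableOn ℂ (fun z => ∑' n, b n * z ^ n) (dilatedDisk r) := by
  intro z hz
  obtain ⟨R, hzR, hrR, -⟩ := exists_ball_subset_dilatedDisk hz
  have hR0 : 0 ≤ R := (norm_nonneg z).trans (by simpa using (mem_ball_zero_iff.mp hzR).le)
  have h := Complex.differentiableOn_tsum_of_summable_norm (F := fun n z => b n * z ^ n)
    (summable_geometric_of_lt_one (mul_nonneg r.2 hR0) hrR)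
    (fun n => (by fun_prop : DifferentiableOn ℂ (fun z => b n * z ^ n) (Metric.ball 0 R)))
    Metric.isOpen_ball fun n w hw => by
      have hw' : ‖w‖ ≤ R := (mem_ball_zero_iff.mp hw).le
      rw [norm_mul, norm_pow, mul_pow]
      exact mul_le_mul (hb n) (pow_le_pow_left₀ (norm_nonneg _) hw' n) (by positivity)
        (pow_nonneg r.2 n)
  exact (h.differentiableAt (Metric.isOpen_ball.mem_nhds hzR)).differentiableWithinAt

/-- Both sides are the same circle average against `conj w ^ n`, so no termwise differentiation is
needed. -/
theorem taylorCoeff_tsum_pow (hr : r < 1) {b : ℕ → ℂ} (hb : ∀ n, ‖b n‖ ≤ (r : ℝ) ^ n) (n : ℕ) :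
    taylorCoeff (fun z => ∑' n, b n * z ^ n) n = b n := by
  have hs : Summable fun n => ‖b n‖ := Summable.of_nonneg_of_le (fun _ => norm_nonneg _) hb
    (summable_geometric_of_lt_one r.2 (by exact_mod_cast hr))
  rw [← (diskAlgebra_of_dilatedDisk hr (differentiableOn_tsum_pow hb)).circleAverage_mul_conj_pow]
  refine circleAverage_mul_conj_pow_of_hasSum hs (fun w hw => Summable.hasSum ?_) n
  have hw : ‖w‖ = 1 := by simpa using hw
  exact Summable.of_norm (by simpa [hw] using hs)

/-- Parseval's identity for a pair of functions of the disk algebra. -/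
theorem hasSum_conj_taylorCoeff_mul {f ψ : ℂ → ℂ} (hf : DiskAlgebra f)
    (hs : Summable fun n => ‖taylorCoeff ψ n‖)
    (hψs : ∀ w ∈ Metric.sphere (0 : ℂ) 1, HasSum (fun n => taylorCoeff ψ n * w ^ n) (ψ w)) :
    HasSum (fun n => conj (taylorCoeff ψ n) * taylorCoeff f n)
      (Real.circleAverage (fun z => f z * conj (ψ z)) 0 1) := by
  obtain ⟨M, hM0, hM⟩ := hf.exists_bound
  have h := hasSum_circleAverage
    (g := fun n w => conj (taylorCoeff ψ n) * (f w * conj w ^ n))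
    (G := fun w => f w * conj (ψ w)) (B := fun n => ‖taylorCoeff ψ n‖ * M)
    (fun n => continuousOn_const.mul (hf.continuousOn_sphere.mul (by fun_prop)))
    (hs.mul_right M) ?_ ?_
  · refine h.congr_fun fun n => ?_
    rw [← hf.circleAverage_mul_conj_pow n]
    exact (Real.circleAverage_fun_smul (a := conj (taylorCoeff ψ n))
      (f := fun w => f w * conj w ^ n)).symm
  · intro n w hw
    rw [norm_mul, norm_mul, RCLike.norm_conj]
    refine mul_le_mul_of_nonneg_left ?_ (norm_nonneg _)
    calc _ ≤ M * 1 := mul_le_mul (hM w (by simpa using (mem_sphere_zero_iff_norm.mp hw).le))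
          (norm_conj_pow_le hw n) (norm_nonneg _) hM0
      _ = M := mul_one M
  · intro w hw
    have h1 := ((hψs w hw).mapL (Complex.conjCLE : ℂ →L[ℝ] ℂ)).mul_left (f w)
    refine h1.congr_fun fun n => ?_
    simp only [ContinuousLinearEquiv.coe_coe, Complex.conjCLE_apply, map_mul, map_pow]
    ring

theorem hasSum_conj_taylorCoeff_mul_of_dilatedDisk (hr : r < 1) {f ψ : ℂ → ℂ}
    (hf : DiskAlgebra f) (hψ : DifferentiableOn ℂ ψ (dilatedDisk r)) :
    HasSum (fun n => conj (taylorCoeff ψ n) * taylorCoeff f n)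
      (Real.circleAverage (fun z => f z * conj (ψ z)) 0 1) :=
  hasSum_conj_taylorCoeff_mul hf (summable_norm_taylorCoeff hr hψ) fun _ hw =>
    hasSum_taylorCoeff_dilatedDisk hψ
      (closedBall_subset_dilatedDisk hr (Metric.sphere_subset_closedBall hw))

/-- A function on the dilated disk is determined by its pairings with the monomials. -/
theorem eqOn_dilatedDisk_of_circleAverage (hr : r < 1) {ψ ψ' : ℂ → ℂ}
    (hψ : DifferentiableOn ℂ ψ (dilatedDisk r)) (hψ' : DifferentiableOn ℂ ψ' (dilatedDisk r))
    (h : ∀ n : ℕ, Real.circleAverage (fun z => z ^ n * conj (ψ z)) 0 1 =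
      Real.circleAverage (fun z => z ^ n * conj (ψ' z)) 0 1) :
    Set.EqOn ψ' ψ (dilatedDisk r) := by
  -- Pairing with `zⁿ` reads off the conjugate of the `n`-th Taylor coefficient.
  have hc : ∀ φ : ℂ → ℂ, DifferentiableOn ℂ φ (dilatedDisk r) → ∀ n : ℕ,
      Real.circleAverage (fun z => z ^ n * conj (φ z)) 0 1 = conj (taylorCoeff φ n) := by
    intro φ hφ n
    rw [← (diskAlgebra_of_dilatedDisk hr hφ).circleAverage_mul_conj_pow, ← circleAverage_conj]
    simp only [map_mul, map_pow, Complex.conj_conj, mul_comm]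
  intro z hz
  refine (hasSum_taylorCoeff_dilatedDisk hψ' hz).unique ?_
  refine (hasSum_taylorCoeff_dilatedDisk hψ hz).congr_fun fun n => ?_
  have hn := h n
  rw [hc ψ hψ, hc ψ' hψ'] at hn
  rw [(starRingEnd ℂ).injective hn]

end DilatedDisk

/-! ### Boundary values in `L²₊(𝕋)` -/

section Circle

theorem toCircle_coe (t : ℝ) :
    ((AddCircle.toCircle (t : AddCircle (2 * Real.pi)) : Circle) : ℂ) = circleMap 0 1 t := by
  rw [AddCircle.toCircle_apply_mk, Circle.coe_exp, circleMap_zero, div_self Real.two_pi_pos.ne']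
  simp

theorem integral_onCircle (g : ℂ → ℂ) :
    ∫ t, onCircle g t ∂(AddCircle.haarAddCircle : Measure (AddCircle (2 * Real.pi))) =
      Real.circleAverage g 0 1 := by
  -- The integral is the zeroth Fourier coefficient, which is known as an interval integral.
  have h := fourierCoeff_eq_intervalIntegral (T := 2 * Real.pi) (onCircle g) 0 0
  simp only [fourierCoeff, neg_zero, fourier_zero, one_smul, zero_add] at h
  rw [h, Real.circleAverage_def, one_div]
  simp only [onCircle, toCircle_coe]

theorem fourierCoeff_onCircle_nat (g : ℂ → ℂ) (n : ℕ) :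
    fourierCoeff (onCircle g) (n : ℤ) = Real.circleAverage (fun w => g w * conj w ^ n) 0 1 := by
  rw [← integral_onCircle, fourierCoeff]
  refine integral_congr_ae (ae_of_all _ fun t => ?_)
  simp only [onCircle, smul_eq_mul]
  rw [fourier_neg, fourier_apply, AddCircle.toCircle_zsmul, zpow_natCast, Circle.coe_pow, map_pow,
    mul_comm]

theorem fourierCoeff_onCircle_neg (g : ℂ → ℂ) (n : ℕ) :
    fourierCoeff (onCircle g) (-(n : ℤ)) = Real.circleAverage (fun w => g w * w ^ n) 0 1 := by
  rw [← integral_onCircle, fourierCoeff]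
  refine integral_congr_ae (ae_of_all _ fun t => ?_)
  simp only [onCircle, smul_eq_mul, neg_neg]
  rw [fourier_apply, AddCircle.toCircle_zsmul, zpow_natCast, Circle.coe_pow, mul_comm]

theorem DiskAlgebra.continuous_onCircle {f : ℂ → ℂ} (hf : DiskAlgebra f) :
    Continuous (onCircle f) :=
  hf.continuousOn_sphere.comp_continuous
    (continuous_subtype_val.comp AddCircle.continuous_toCircle) fun _ =>
      mem_sphere_zero_iff_norm.mpr (Circle.norm_coe _)

theorem DiskAlgebra.memLp_onCircle {f : ℂ → ℂ} (hf : DiskAlgebra f) :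
    MemLp (onCircle f) 2 (AddCircle.haarAddCircle : Measure (AddCircle (2 * Real.pi))) := by
  obtain ⟨M, -, hM⟩ := hf.exists_bound
  exact MemLp.of_bound hf.continuous_onCircle.aestronglyMeasurable M
    (ae_of_all _ fun t => hM _ (Circle.norm_coe _).le)

/-- The boundary values of a function of the disk algebra lie in `L²₊(𝕋)`, and its Taylor
coefficients, which are its Fourier coefficients, lie in `l²(ℕ)`. -/
theorem DiskAlgebra.exists_boundary_values {f : ℂ → ℂ} (hf : DiskAlgebra f) :
    ∃ (F : L2Plus) (a : lp (fun _ : ℕ => ℂ) 2),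
      ((F : L2Circle) : AddCircle (2 * Real.pi) → ℂ)
        =ᵐ[AddCircle.haarAddCircle] onCircle f ∧
      ∀ n : ℕ, a n = taylorCoeff f n ∧ a n = fourierCoeff (F : L2Circle) n := by
  set F : L2Circle := hf.memLp_onCircle.toLp (onCircle f) with hF
  have hFf : (F : AddCircle (2 * Real.pi) → ℂ) =ᵐ[AddCircle.haarAddCircle] onCircle f :=
    hf.memLp_onCircle.coeFn_toLp
  have hcoef : fourierCoeff F = fourierCoeff (onCircle f) := fourierCoeff_congr_ae hFf
  have hpos : ∀ n : ℕ, fourierCoeff F n = taylorCoeff f n := fun n => by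
    rw [hcoef, fourierCoeff_onCircle_nat, hf.circleAverage_mul_conj_pow]
  have hneg : F ∈ L2Plus := by
    intro n hn
    obtain ⟨m, rfl⟩ : ∃ m : ℕ, n = -(m : ℤ) := ⟨n.natAbs, by omega⟩
    rw [hcoef, fourierCoeff_onCircle_neg, hf.circleAverage_mul_pow (by omega)]
  have hmem : Memℓp (fun n : ℕ => taylorCoeff f n) 2 := by
    refine memℓp_gen ?_
    -- Square summability is Parseval's series on the circle, restricted to nonnegative indices.
    have h := (hasSum_sq_fourierCoeff F).summable.comp_injective Nat.cast_injective
    refine h.congr fun n => ?_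
    simp [hpos n]
  exact ⟨⟨F, hneg⟩, ⟨_, hmem⟩, hFf, fun n => ⟨rfl, (hpos n).symm⟩⟩

theorem inner_L2Plus_eq_circleAverage {F G : L2Plus} {f g : ℂ → ℂ}
    (hF : ((F : L2Circle) : AddCircle (2 * Real.pi) → ℂ)
      =ᵐ[AddCircle.haarAddCircle] onCircle f)
    (hG : ((G : L2Circle) : AddCircle (2 * Real.pi) → ℂ)
      =ᵐ[AddCircle.haarAddCircle] onCircle g) :
    ⟪G, F⟫_ℂ = Real.circleAverage (fun z => f z * conj (g z)) 0 1 := by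
  rw [Submodule.coe_inner, L2.inner_def, ← integral_onCircle]
  refine integral_congr_ae ?_
  filter_upwards [hF, hG] with t h1 h2
  rw [h1, h2]
  rfl

end Circle

/-! ### The density on the disk -/

section DiskIntegral

/-- Integration over the unit disk in polar coordinates. -/
theorem integral_ball_eq_integral_circleAverage {g : ℂ → ℂ}
    (hg : ContinuousOn g (Metric.closedBall 0 1)) :
    ∫ z in Metric.ball (0 : ℂ) 1, g z =
      ∫ ρ in Set.Ioo (0 : ℝ) 1, (2 * Real.pi * ρ) • Real.circleAverage g 0 ρ := by
  have hpolar : ∀ ρ θ : ℝ, Complex.polarCoord.symm (ρ, θ) = circleMap 0 ρ θ := fun ρ θ => by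
    rw [Complex.polarCoord_symm_apply, circleMap_zero, Complex.exp_mul_I, Complex.ofReal_cos,
      Complex.ofReal_sin]
  set h : ℝ × ℝ → ℂ := fun p => p.1 • g (circleMap 0 p.1 p.2) with hh
  have hcircle : Continuous fun p : ℝ × ℝ => circleMap 0 p.1 p.2 := by
    simp only [circleMap_zero]
    fun_prop
  have hcont : ContinuousOn h (Set.Icc 0 1 ×ˢ Set.Icc (-Real.pi) Real.pi) := by
    refine continuousOn_fst.smul (hg.comp hcircle.continuousOn fun p hp => ?_)
    rw [Set.mem_prod, Set.mem_Icc] at hp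
    simpa [abs_of_nonneg hp.1.1] using hp.1.2
  have hint : IntegrableOn h (Set.Ioo 0 1 ×ˢ Set.Ioo (-Real.pi) Real.pi)
      ((volume : Measure ℝ).prod volume) :=
    (hcont.integrableOn_compact (isCompact_Icc.prod isCompact_Icc)).mono_set
      (Set.prod_mono Set.Ioo_subset_Icc_self Set.Ioo_subset_Icc_self)
  have h1 : ∫ z in Metric.ball (0 : ℂ) 1, g z =
      ∫ p in Set.Ioo (0 : ℝ) 1 ×ˢ Set.Ioo (-Real.pi) Real.pi, h p := by
    rw [← integral_indicator Metric.isOpen_ball.measurableSet,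
      ← Complex.integral_comp_polarCoord_symm, polarCoord_target,
      ← integral_indicator (measurableSet_Ioi.prod measurableSet_Ioo),
      ← integral_indicator (measurableSet_Ioo.prod measurableSet_Ioo)]
    congr 1
    funext ⟨ρ, θ⟩
    by_cases hρ : 0 < ρ
    · have hmem : ρ ∈ Set.Ioo (0 : ℝ) 1 ↔ ρ < 1 := by simp [hρ]
      by_cases hρ1 : ρ < 1 <;> by_cases hθ : θ ∈ Set.Ioo (-Real.pi) Real.pi <;>
        simp [Set.indicator, hpolar, hρ, hρ1, hθ, hh, hmem, abs_of_pos hρ,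
          -Complex.polarCoord_symm_apply, -Set.mem_Ioo]
    · simp [Set.indicator, hρ]
  rw [h1, Measure.volume_eq_prod, setIntegral_prod h hint]
  refine setIntegral_congr_fun measurableSet_Ioo fun ρ _ => ?_
  -- The angular interval is moved from `[0, 2π]` to `[-π, π]` to match polar coordinates.
  have h2 := Real.circleAverage_eq_integral_add (f := g) (c := 0) (R := ρ) (-Real.pi)
  rw [intervalIntegral.integral_comp_add_right fun θ => g (circleMap 0 ρ θ), zero_add,
    show 2 * Real.pi + -Real.pi = Real.pi by ring, eq_inv_smul_iff₀ Real.two_pi_pos.ne'] at h2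
  simp only [hh]
  rw [integral_smul, ← integral_Ioc_eq_integral_Ioo,
    ← intervalIntegral.integral_of_le (by linarith [Real.pi_pos]), ← h2, smul_smul, mul_comm]

/-- On the circle of radius `ρ` the average is `a_n ρ^{2n}`; the radial integral of `2πρ · ρ^{2n}`
over `(0, 1)` is `π / (n + 1)`. -/
theorem DiskAlgebra.integral_ball_mul_conj_pow {f : ℂ → ℂ} (hf : DiskAlgebra f) (n : ℕ) :
    ∫ z in Metric.ball (0 : ℂ) 1, f z * conj z ^ n = Real.pi / (n + 1) * taylorCoeff f n := by
  rw [integral_ball_eq_integral_circleAverage (g := fun z => f z * conj z ^ n)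
    (hf.continuousOn.mul (by fun_prop))]
  have h1 : ∀ ρ ∈ Set.Ioo (0 : ℝ) 1,
      (2 * Real.pi * ρ) • Real.circleAverage (fun z => f z * conj z ^ n) 0 ρ =
        ((ρ ^ (2 * n + 1) : ℝ) : ℂ) * (2 * Real.pi * taylorCoeff f n) := by
    intro ρ hρ
    have h2 := circleAverage_mul_conj_pow_of_hasSum (hf.summable_norm hρ.1.le hρ.2)
      (fun w hw => hf.hasSum_dilate hρ.1.le hρ.2 (mem_sphere_zero_iff_norm.mp hw).le) n
    have h3 : Real.circleAverage (fun z => f z * conj z ^ n) 0 ρ =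
        (ρ : ℂ) ^ n * (taylorCoeff f n * (ρ : ℂ) ^ n) := by
      rw [Real.circleAverage_eq_circleAverage_zero_one, ← h2]
      refine Eq.trans ?_ (Real.circleAverage_fun_smul (a := (ρ : ℂ) ^ n)
        (f := fun w => f (ρ * w) * conj w ^ n))
      congr 1
      funext w
      simp only [add_zero, map_mul, Complex.conj_ofReal, smul_eq_mul]
      ring
    rw [h3, Complex.real_smul]
    push_cast
    ring
  rw [setIntegral_congr_fun measurableSet_Ioo h1, integral_mul_const, integral_complex_ofReal,
    ← integral_Ioc_eq_integral_Ioo, ← intervalIntegral.integral_of_le zero_le_one, integral_pow]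
  have : (n : ℂ) + 1 ≠ 0 := by exact_mod_cast n.succ_ne_zero
  push_cast
  rw [one_pow, zero_pow (by omega), sub_zero, show (2 * n + 1 + 1 : ℂ) = 2 * (n + 1) by ring]
  field_simp

theorem hasSum_integral_ball_mul_conj {f G : ℂ → ℂ} (hf : DiskAlgebra f) {c : ℕ → ℂ}
    (hc : Summable fun n => ‖c n‖)
    (hG : ∀ z ∈ Metric.ball (0 : ℂ) 1, HasSum (fun n => c n * z ^ n) (G z)) :
    HasSum (fun n => conj (c n) * (Real.pi / (n + 1) * taylorCoeff f n))
      (∫ z in Metric.ball (0 : ℂ) 1, f z * conj (G z)) := by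
  obtain ⟨M, hM0, hM⟩ := hf.exists_bound
  have h := hasSum_integral_of_dominated_convergence
    (μ := volume.restrict (Metric.ball (0 : ℂ) 1))
    (F := fun n z => conj (c n) * (f z * conj z ^ n)) (f := fun z => f z * conj (G z))
    (fun n _ => ‖c n‖ * M) (fun n => ?_) (fun n => ?_) (ae_of_all _ fun _ => hc.mul_right M) ?_ ?_
  · refine h.congr_fun fun n => ?_
    rw [integral_const_mul, hf.integral_ball_mul_conj_pow]
  · refine ContinuousOn.aestronglyMeasurable ?_ Metric.isOpen_ball.measurableSet
    exact continuousOn_const.mul ((hf.continuousOn.mono Metric.ball_subset_closedBall).mul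
      (by fun_prop))
  · refine (ae_restrict_iff' Metric.isOpen_ball.measurableSet).mpr (ae_of_all _ fun z hz => ?_)
    have hz1 : ‖z‖ ≤ 1 := (mem_ball_zero_iff.mp hz).le
    rw [norm_mul, norm_mul, RCLike.norm_conj, norm_pow, RCLike.norm_conj]
    refine mul_le_mul_of_nonneg_left ?_ (norm_nonneg _)
    calc _ ≤ M * 1 := mul_le_mul (hM z hz1) (pow_le_one₀ (norm_nonneg _) hz1) (by positivity) hM0
      _ = M := mul_one M
  · exact integrableOn_const measure_ball_lt_top.ne
  · refine (ae_restrict_iff' Metric.isOpen_ball.measurableSet).mpr (ae_of_all _ fun z hz => ?_)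
    have h1 := ((hG z hz).mapL (Complex.conjCLE : ℂ →L[ℝ] ℂ)).mul_left (f z)
    refine h1.congr_fun fun n => ?_
    simp only [ContinuousLinearEquiv.coe_coe, Complex.conjCLE_apply, map_mul, map_pow]
    ring

end DiskIntegral

/-! ### The density as the conjugate of a holomorphic derivative. -/

section Density

/-- The Poisson kernel is real, so conjugation passes through the formula that reproduces `ψ`. -/
theorem poissonIntegral_conj {ψ : ℂ → ℂ} (hψ : DiskAlgebra ψ) {z : ℂ}
    (hz : z ∈ Metric.ball (0 : ℂ) 1) :
    poissonIntegral (fun v => conj (ψ v)) z = conj (ψ z) := by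
  rw [← DiffContOnCl.circleAverage_poissonKernel_smul hψ hz, ← circleAverage_conj, poissonIntegral]
  congr 1
  funext w
  simp [Complex.real_smul]

theorem hasFDerivAt_conj_comp {h : ℂ → ℂ} {z : ℂ} (hh : DifferentiableAt ℂ h z) :
    HasFDerivAt (fun w => conj (h w))
      ((Complex.conjCLE : ℂ →L[ℝ] ℂ) ∘L (fderiv ℂ h z).restrictScalars ℝ) z :=
  (Complex.conjCLE : ℂ →L[ℝ] ℂ).hasFDerivAt.comp z (hh.hasFDerivAt.restrictScalars ℝ)

theorem dbar_conj_comp {h : ℂ → ℂ} {z : ℂ} (hh : DifferentiableAt ℂ h z) :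
    dbar (fun w => conj (h w)) z = conj (deriv h z) := by
  have h1 : fderiv ℂ h z Complex.I = deriv h z * Complex.I := by
    rw [fderiv_eq_smul_deriv, smul_eq_mul, mul_comm]
  rw [dbar, (hasFDerivAt_conj_comp hh).fderiv]
  simp only [ContinuousLinearMap.comp_apply, ContinuousLinearMap.coe_restrictScalars',
    ContinuousLinearEquiv.coe_coe, Complex.conjCLE_apply, h1, fderiv_apply_one_eq_deriv,
    map_mul, Complex.conj_I]
  linear_combination (-(1 / 2) * conj (deriv h z)) * Complex.I_mul_I

variable {ψ : ℂ → ℂ}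

theorem conj_mul_poissonIntegral_eventuallyEq (hψ : DiskAlgebra ψ) {z : ℂ}
    (hz : z ∈ Metric.ball (0 : ℂ) 1) :
    (fun w => conj w * poissonIntegral (fun v => conj (ψ v)) w) =ᶠ[𝓝 z]
      fun w => conj (ψ w * w) := by
  filter_upwards [Metric.isOpen_ball.mem_nhds hz] with w hw
  rw [poissonIntegral_conj hψ hw, map_mul, mul_comm]

theorem DiskAlgebra.differentiableAt_mul_id (hψ : DiskAlgebra ψ) {z : ℂ}
    (hz : z ∈ Metric.ball (0 : ℂ) 1) : DifferentiableAt ℂ (fun w => ψ w * w) z :=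
  (hψ.differentiableOn.differentiableAt (Metric.isOpen_ball.mem_nhds hz)).mul
    differentiableAt_id

theorem differentiableAt_conj_mul_poissonIntegral (hψ : DiskAlgebra ψ) {z : ℂ}
    (hz : z ∈ Metric.ball (0 : ℂ) 1) :
    DifferentiableAt ℝ (fun w => conj w * poissonIntegral (fun v => conj (ψ v)) w) z :=
  (conj_mul_poissonIntegral_eventuallyEq hψ hz).symm.differentiableAt_iff.mp
    (hasFDerivAt_conj_comp (hψ.differentiableAt_mul_id hz)).differentiableAt

theorem diskDensity_conj (hψ : DiskAlgebra ψ) {z : ℂ} (hz : z ∈ Metric.ball (0 : ℂ) 1) :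
    diskDensity (fun v => conj (ψ v)) z = (1 / Real.pi) * dbar (fun w => conj (ψ w * w)) z := by
  rw [diskDensity, dbar, (conj_mul_poissonIntegral_eventuallyEq hψ hz).fderiv_eq]
  ring

theorem diskDensity_conj_eq_deriv (hψ : DiskAlgebra ψ) {z : ℂ}
    (hz : z ∈ Metric.ball (0 : ℂ) 1) :
    diskDensity (fun v => conj (ψ v)) z = (1 / Real.pi) * conj (deriv (fun w => ψ w * w) z) := by
  rw [diskDensity_conj hψ hz, dbar_conj_comp (hψ.differentiableAt_mul_id hz)]

theorem taylorCoeff_deriv (h : ℂ → ℂ) (n : ℕ) :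
    taylorCoeff (deriv h) n = (n + 1) * taylorCoeff h (n + 1) := by
  have h1 : (n : ℂ) + 1 ≠ 0 := by exact_mod_cast n.succ_ne_zero
  have h2 : (n.factorial : ℂ) ≠ 0 := by exact_mod_cast n.factorial_ne_zero
  rw [taylorCoeff, taylorCoeff, iteratedDeriv_succ', Nat.factorial_succ]
  push_cast
  field_simp

/-- As circle averages the two coefficients agree because `conj w * w = 1` on the circle. -/
theorem DiskAlgebra.taylorCoeff_mul_id (hψ : DiskAlgebra ψ) (n : ℕ) :
    taylorCoeff (fun w => ψ w * w) (n + 1) = taylorCoeff ψ n := by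
  have h : DiskAlgebra fun w => ψ w * w := DiffContOnCl.smul hψ differentiable_id.diffContOnCl
  rw [← h.circleAverage_mul_conj_pow, ← hψ.circleAverage_mul_conj_pow]
  refine Real.circleAverage_congr_sphere fun w hw => ?_
  have hw' := conj_mul_self_of_mem_sphere (w := w) (by simpa using hw)
  linear_combination (ψ w * conj w ^ n) * hw'

variable {r : ℝ≥0}

/-- The density is `conj G / π` with `G = (zψ)'`, whose coefficients `(n + 1) b_n` cancel the
factors `π / (n + 1)` of the disk integrals and leave Parseval's series. Holomorphy of `G` beyond
the closed disk gives integrability. -/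
theorem diskDensity_integral (hr : r < 1) (hψ : DifferentiableOn ℂ ψ (dilatedDisk r)) {f : ℂ → ℂ}
    (hf : DiskAlgebra f) :
    IntegrableOn (fun z => f z * diskDensity (fun v => conj (ψ v)) z) (Metric.ball 0 1) ∧
      ∫ z in Metric.ball (0 : ℂ) 1, f z * diskDensity (fun v => conj (ψ v)) z =
        Real.circleAverage (fun z => f z * conj (ψ z)) 0 1 := by
  have hψA := diskAlgebra_of_dilatedDisk hr hψ
  set G := deriv (fun w => ψ w * w) with hG
  have hGd : DifferentiableOn ℂ G (dilatedDisk r) :=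
    (hψ.mul differentiableOn_id).deriv (isOpen_dilatedDisk r)
  have hGA := diskAlgebra_of_dilatedDisk hr hGd
  have heq : Set.EqOn (fun z => f z * diskDensity (fun v => conj (ψ v)) z)
      (fun z => (1 / Real.pi : ℂ) * (f z * conj (G z))) (Metric.ball 0 1) := fun z hz => by
    simp only
    rw [diskDensity_conj_eq_deriv hψA hz]
    ring
  have hcont : ContinuousOn (fun z => (1 / Real.pi : ℂ) * (f z * conj (G z)))
      (Metric.closedBall 0 1) :=
    continuousOn_const.mul (hf.continuousOn.mul
      (Complex.continuous_conj.comp_continuousOn hGA.continuousOn))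
  refine ⟨?_, ?_⟩
  · exact ((hcont.integrableOn_compact (isCompact_closedBall 0 1)).mono_set
      Metric.ball_subset_closedBall).congr_fun heq.symm Metric.isOpen_ball.measurableSet
  · rw [setIntegral_congr_fun Metric.isOpen_ball.measurableSet heq, integral_const_mul]
    have h1 := (hasSum_integral_ball_mul_conj hf (summable_norm_taylorCoeff hr hGd)
      fun z hz => hasSum_taylorCoeff hGA.differentiableOn hz).mul_left (1 / Real.pi : ℂ)
    refine h1.unique ?_
    refine (hasSum_conj_taylorCoeff_mul_of_dilatedDisk hr hf hψ).congr_fun fun n => ?_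
    have h2 : (n : ℂ) + 1 ≠ 0 := by exact_mod_cast n.succ_ne_zero
    have h3 : (Real.pi : ℂ) ≠ 0 := by exact_mod_cast Real.pi_ne_zero
    rw [hG, taylorCoeff_deriv, hψA.taylorCoeff_mul_id, map_mul, map_add, map_natCast, map_one]
    field_simp

end Density

end DOS
-- The representation theorem, from the decay of the moments.
theorem mainTheorem6
    {d : ℕ} (hd : 0 < d)
    {X : Set ℝ} (μ : Measure X) [IsProbabilityMeasure μ]
    (γ : Fin d → DOS.Site d) (hγ : LinearIndependent ℤ γ)
    -- the random contraction
    (T : DOS.Sample d X → DOS.Hil d →L[ℂ] DOS.Hil d)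
    (hT_meas : ∀ x y : DOS.Hil d, Measurable fun ω => ⟪x, T ω y⟫_ℂ)
    (hT_contr : ∀ ω, ‖T ω‖ ≤ 1)
    (hT_cnu : ∀ ω, DOS.IsCNU (T ω))
    (hT_erg : ∀ g ∈ DOS.lattice γ, ∀ ω x,
      T (DOS.shift g ω) x = DOS.translation g (T ω ((DOS.translation g).symm x)))
    -- the finite volume approximations
    (TΛ : ∀ n : ℕ, DOS.Sample d X →
      DOS.boxSpace (DOS.box γ n) →L[ℂ] DOS.boxSpace (DOS.box γ n))
    (TΛc : ∀ n : ℕ, DOS.Sample d X →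
      (DOS.boxSpace (DOS.box γ n))ᗮ →L[ℂ] (DOS.boxSpace (DOS.box γ n))ᗮ)
    (hΛ_contr : ∀ n ω, ‖TΛ n ω‖ ≤ 1)
    (hΛ_cnu : ∀ n ω, DOS.IsCNU (TΛ n ω))
    (hΛ_tc : ∀ n ω, DOS.IsTraceClass
      (T ω - DOS.blockSum (DOS.boxSpace (DOS.box γ n)) (TΛ n ω) (TΛc n ω)))
    (hΛ_lim : ∀ ω, Tendsto
      (fun n : ℕ => DOS.traceNorm ((DOS.boxSpace (DOS.box γ n)).starProjection ∘L
          (T ω - DOS.blockSum (DOS.boxSpace (DOS.box γ n)) (TΛ n ω) (TΛc n ω))) /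
        ((DOS.box γ n).card : ℝ≥0∞)) atTop (𝓝 0))
    (r : ℝ≥0) (hr : r < 1)
    (hspr : ∀ n ω, spectralRadius ℂ (TΛ n ω) ≤ (r : ℝ≥0∞)) :
    -- the functional calculus and the expectations defining `L` make sense on the disk algebra
    (∀ f, DOS.DiskAlgebra f →
      (∀ ω, ∀ ρ ∈ Set.Ico (0 : ℝ) 1,
        Summable fun n : ℕ => (DOS.taylorCoeff f n * (ρ : ℂ) ^ n) • T ω ^ n) ∧
      (∀ ω x, Tendsto (fun ρ : ℝ => DOS.calcAbel (T ω) f ρ x) (𝓝[<] 1)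
        (𝓝 (DOS.funcCalc (T ω) f x))) ∧
      (∀ b ∈ DOS.cell γ, Integrable
        (fun ω => ⟪DOS.basisVec b, DOS.funcCalc (T ω) f (DOS.basisVec b)⟫_ℂ)
        (DOS.prodMeasure d μ))) ∧
    ∃ ψ : ℂ → ℂ,
      -- `ψ` is holomorphic on `𝔻 / r`, and `L` is integration against its conjugate on the circle
      DifferentiableOn ℂ ψ (DOS.dilatedDisk r) ∧
      (∀ f, DOS.DiskAlgebra f →
        DOS.dos μ γ T f = Real.circleAverage (fun z => f z * conj (ψ z)) 0 1) ∧
      -- these properties determine `ψ`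
      (∀ ψ' : ℂ → ℂ, DifferentiableOn ℂ ψ' (DOS.dilatedDisk r) →
        (∀ f, DOS.DiskAlgebra f →
          DOS.dos μ γ T f = Real.circleAverage (fun z => f z * conj (ψ' z)) 0 1) →
        Set.EqOn ψ' ψ (DOS.dilatedDisk r)) ∧
      -- `ψ(z) = ∑ b_n z^n` on `𝔻 / r`
      (∀ z ∈ DOS.dilatedDisk r, HasSum (fun n : ℕ => DOS.taylorCoeff ψ n * z ^ n) (ψ z)) ∧
      -- `L(f) = ⟨ψ, f⟩` in `L²₊(𝕋)` and in `l²(ℕ)`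
      (∃ (Ψ : DOS.L2Plus) (b : lp (fun _ : ℕ => ℂ) 2),
        ((Ψ : DOS.L2Circle) : AddCircle (2 * Real.pi) → ℂ)
          =ᵐ[AddCircle.haarAddCircle] DOS.onCircle ψ ∧
        (∀ n : ℕ, b n = DOS.taylorCoeff ψ n ∧ b n = fourierCoeff (Ψ : DOS.L2Circle) n) ∧
        ∀ f, DOS.DiskAlgebra f →
          ∃ (F : DOS.L2Plus) (a : lp (fun _ : ℕ => ℂ) 2),
            ((F : DOS.L2Circle) : AddCircle (2 * Real.pi) → ℂ)
              =ᵐ[AddCircle.haarAddCircle] DOS.onCircle f ∧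
            (∀ n : ℕ, a n = DOS.taylorCoeff f n ∧ a n = fourierCoeff (F : DOS.L2Circle) n) ∧
            DOS.dos μ γ T f = ⟪Ψ, F⟫_ℂ ∧
            ⟪Ψ, F⟫_ℂ = ⟪b, a⟫_ℂ ∧
            HasSum (fun n : ℕ => conj (DOS.taylorCoeff ψ n) * DOS.taylorCoeff f n)
              (DOS.dos μ γ T f)) ∧
      -- the density on the disk associated with `φ = conj ψ`
      (∀ z ∈ Metric.ball (0 : ℂ) 1,
        DifferentiableAt ℝ
          (fun w => conj w * DOS.poissonIntegral (fun v => conj (ψ v)) w) z ∧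
        DOS.diskDensity (fun v => conj (ψ v)) z =
          (1 / Real.pi) * DOS.dbar (fun w => conj (ψ w * w)) z) ∧
      (∀ f, DOS.DiskAlgebra f →
        IntegrableOn (fun z => f z * DOS.diskDensity (fun v => conj (ψ v)) z)
          (Metric.ball 0 1) ∧
        DOS.dos μ γ T f =
          ∫ z in Metric.ball (0 : ℂ) 1, f z * DOS.diskDensity (fun v => conj (ψ v)) z) := by
  have hm : ∀ n, ‖DOS.moment μ γ T n‖ ≤ (r : ℝ) ^ n :=
    DOS.norm_moment_le μ hγ hT_meas hT_contr hT_erg TΛ TΛc hΛ_contr hΛ_lim hspr hr.le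
  -- The coefficients of `ψ` are the conjugated moments, since `ψ` enters the pairing conjugated.
  have hb : ∀ n, ‖conj (DOS.moment μ γ T n)‖ ≤ (r : ℝ) ^ n := fun n => by
    rw [RCLike.norm_conj]
    exact hm n
  refine ⟨fun f hf => ⟨fun ω ρ hρ =>
      (hf.summable_norm_calcAbel (hT_contr ω) hρ.1 hρ.2).of_norm,
    fun ω x => hf.tendsto_calcAbel_apply (hT_contr ω) x,
    fun b _ => DOS.integrable_inner_funcCalc μ hT_meas hT_contr hf b⟩, ?_⟩
  have hψ := DOS.differentiableOn_tsum_pow hb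
  have hcoeff := DOS.taylorCoeff_tsum_pow hr hb
  -- From here only holomorphy of `ψ` and its Taylor coefficients matter.
  generalize (fun z : ℂ => ∑' n, conj (DOS.moment μ γ T n) * z ^ n) = ψ at hψ hcoeff
  have hψA := DOS.diskAlgebra_of_dilatedDisk hr hψ
  have hL : ∀ f, DOS.DiskAlgebra f →
      HasSum (fun n : ℕ => conj (DOS.taylorCoeff ψ n) * DOS.taylorCoeff f n)
        (DOS.dos μ γ T f) := fun f hf => by
    refine (DOS.hasSum_dos μ γ hT_meas hT_contr r.2 (by exact_mod_cast hr) hm hf).congr_fun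
      fun n => ?_
    rw [hcoeff, Complex.conj_conj, mul_comm]
  have hcircle : ∀ f, DOS.DiskAlgebra f →
      DOS.dos μ γ T f = Real.circleAverage (fun z => f z * conj (ψ z)) 0 1 := fun f hf =>
    (hL f hf).unique (DOS.hasSum_conj_taylorCoeff_mul_of_dilatedDisk hr hf hψ)
  refine ⟨ψ, hψ, hcircle, fun ψ' hψ' h' => ?_,
    fun z hz => DOS.hasSum_taylorCoeff_dilatedDisk hψ hz, ?_, fun z hz =>
      ⟨DOS.differentiableAt_conj_mul_poissonIntegral hψA hz, DOS.diskDensity_conj hψA hz⟩,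
    fun f hf => ?_⟩
  · exact DOS.eqOn_dilatedDisk_of_circleAverage hr hψ hψ' fun n =>
      (hcircle _ (DOS.diskAlgebra_pow n)).symm.trans (h' _ (DOS.diskAlgebra_pow n))
  · obtain ⟨Ψ, b, hΨ, hb⟩ := hψA.exists_boundary_values
    refine ⟨Ψ, b, hΨ, hb, fun f hf => ?_⟩
    obtain ⟨F, a, hF, ha⟩ := hf.exists_boundary_values
    have hinner := DOS.inner_L2Plus_eq_circleAverage hF hΨ
    refine ⟨F, a, hF, ha, (hcircle f hf).trans hinner.symm, ?_, hL f hf⟩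
    rw [hinner, ← hcircle f hf]
    refine (hL f hf).unique ((lp.hasSum_inner b a).congr_fun fun n => ?_)
    rw [← (hb n).1, ← (ha n).1, RCLike.inner_apply, mul_comm]
  · obtain ⟨h1, h2⟩ := DOS.diskDensity_integral hr hψ hf
    exact ⟨h1, (hcircle f hf).trans h2.symm⟩
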